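/- **Theorem.** Let $\Sigma\subset\mathbb R^3$ be the image of $$F_0(u,v)=\big((3+2\cos u)\cos v,\ (3+2\cos u)\sin v,\ \sqrt2\,\sin u\big),\qquad (u,v)\in\mathbb T^2=(\mathbb R/2\pi\mathbb Z)^2 .$$ For an immersion of $\mathbb T^2$ with unit normal $N$ (outward along $\Sigma$, and chosen continuously in time along a flow) let $H$ be the mean curvature, i.e. the sum of the eigenvalues of the shape operator $X\mapsto\nabla_XN$, and let $d\mu$ be the induced area element. Then: 1. $F_0$ is a smooth embedding, and $\Sigma$ is the torus of revolution obtained by rotating the ellipse $\big(\tfrac{r-3}{2}\big)^2+\big(\tfrac{z}{\sqrt2}\big)^2=1$ of the $(r,z)$-half-plane about the $z$-axis. 2. $H=0$ along the inner equator $\Gamma=\{F_0(\pi,v): v\in\mathbb R\}$, and $H>0$ on $\Sigma\setminus\Gamma$. 3. Let $T>0$ and let $F:\mathbb T^2\times[0,T)\to\mathbb R^3$ be a smooth family of immersions (smooth up to $t=0$) with $F(\cdot,0)=F_0$ and $$\frac{\partial F}{\partial t}(p,t)=\big(h(t)-H(p,t)\big)N(p,t),\qquad p\in\mathbb T^2,\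 t\in(0,T),$$ where either $h(t)=\int H\,d\mu_t\big/\int d\mu_t$ (volume preserving mean curvature flow), or $h(t)=\int H^2\,d\mu_t\big/\int H\,d\mu_t$ with $\int H\,d\mu_t\neq0$ (area preserving mean curvature flow). Then there is $\varepsilon\in(0,T]$ such that for all $t\in(0,\varepsilon)$ one has $H\big((\pi,v),t\big)<0$ for every $v$; in particular $\inf_{\mathbb T^2}H(\cdot,t)<0$. -/

import Mathlib

open Real Set Filter Topology
open scoped ContDiff Matrix

noncomputable section

/-- Euclidean three-space. -/
abbrev E3 := EuclideanSpace ℝ (Fin 3)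

/-- The cross product of `ℝ³`. -/
def cross (a b : E3) : E3 := WithLp.toLp 2 (crossProduct a.ofLp b.ofLp)

/-- Partial derivative with respect to the first parameter. -/
def du (X : ℝ → ℝ → E3) (u v : ℝ) : E3 := deriv (fun s => X s v) u

/-- Partial derivative with respect to the second parameter. -/
def dv (X : ℝ → ℝ → E3) (u v : ℝ) : E3 := deriv (fun s => X u s) v

/-- A smooth immersion of the torus `(ℝ / 2πℤ)²` into `ℝ³`, given by its doubly
periodic lift to `ℝ²`. -/
structure IsTorusImmersion (X : ℝ → ℝ → E3) : Prop where
  smooth : ContDiff ℝ ∞ (fun p : ℝ × ℝ => X p.1 p.2)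
  periodic_u : ∀ u v, X (u + 2 * π) v = X u v
  periodic_v : ∀ u v, X u (v + 2 * π) = X u v
  immersive : ∀ u v, LinearIndependent ℝ ![du X u v, dv X u v]

/-- A smooth embedding of the (compact) torus: an immersion that is injective on
`(ℝ / 2πℤ)²`. -/
structure IsTorusEmbedding (X : ℝ → ℝ → E3) : Prop extends IsTorusImmersion X where
  injective : ∀ u v u' v', X u v = X u' v' →
    ∃ m n : ℤ, u' = u + m * (2 * π) ∧ v' = v + n * (2 * π)

/-- The unit normal field `N = (∂ᵥX × ∂ᵤX) / |∂ᵥX × ∂ᵤX|`. -/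
def unitNormal (X : ℝ → ℝ → E3) (u v : ℝ) : E3 :=
  ‖cross (dv X u v) (du X u v)‖⁻¹ • cross (dv X u v) (du X u v)

/-- The matrix `(g_ij)` of the induced metric, `g_ij = ⟨∂ᵢX, ∂ⱼX⟩`. -/
def firstFundamentalForm (X : ℝ → ℝ → E3) (u v : ℝ) : Matrix (Fin 2) (Fin 2) ℝ :=
  !![inner ℝ (du X u v) (du X u v), inner ℝ (du X u v) (dv X u v);
     inner ℝ (dv X u v) (du X u v), inner ℝ (dv X u v) (dv X u v)]

/-- The matrix `(h_ij)` of the second fundamental form, `h_ij = ⟨∂ᵢN, ∂ⱼX⟩`. -/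
def secondFundamentalForm (X : ℝ → ℝ → E3) (u v : ℝ) : Matrix (Fin 2) (Fin 2) ℝ :=
  !![inner ℝ (du (unitNormal X) u v) (du X u v), inner ℝ (du (unitNormal X) u v) (dv X u v);
     inner ℝ (dv (unitNormal X) u v) (du X u v), inner ℝ (dv (unitNormal X) u v) (dv X u v)]

/-- The shape operator `A = g⁻¹ h`; its eigenvalues are the principal curvatures. -/
def shapeOperator (X : ℝ → ℝ → E3) (u v : ℝ) : Matrix (Fin 2) (Fin 2) ℝ :=
  (firstFundamentalForm X u v)⁻¹ * secondFundamentalForm X u v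

/-- The mean curvature, the sum of the principal curvatures: `H = tr A`. -/
def meanCurvature (X : ℝ → ℝ → E3) (u v : ℝ) : ℝ := (shapeOperator X u v).trace

/-- The integral of `f` over the torus against the induced area element
`dμ = √(det g) du dv`. -/
def surfaceIntegral (X : ℝ → ℝ → E3) (f : ℝ → ℝ → ℝ) : ℝ :=
  ∫ u in (0 : ℝ)..(2 * π), ∫ v in (0 : ℝ)..(2 * π), f u v * √(firstFundamentalForm X u v).det

/-- The average mean curvature `∫ H dμ / ∫ dμ`. -/
def averageMeanCurvature (X : ℝ → ℝ → E3) : ℝ :=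
  surfaceIntegral X (meanCurvature X) / surfaceIntegral X (fun _ _ => 1)

/-- The quotient `∫ H² dμ / ∫ H dμ` (meaningful when `∫ H dμ ≠ 0`). -/
def squareMeanCurvatureRatio (X : ℝ → ℝ → E3) : ℝ :=
  surfaceIntegral X (fun u v => meanCurvature X u v ^ 2) / surfaceIntegral X (meanCurvature X)

/-- `F` (with `F t u v` the position at time `t`) is a smooth solution on `[0, T)` of
`∂F/∂t = (h(t) - H) N`, `F(·, 0) = X₀`, through immersions of the torus, where the global term
at time `t` is `h (F t)`. -/
structure IsConstrainedMCF (h : (ℝ → ℝ → E3) → ℝ) (X₀ : ℝ → ℝ → E3) (T : ℝ)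
    (F : ℝ → ℝ → ℝ → E3) : Prop where
  smooth : ContDiffOn ℝ ∞ (fun q : ℝ × ℝ × ℝ => F q.1 q.2.1 q.2.2) (Ico 0 T ×ˢ univ)
  immersion : ∀ t ∈ Ico 0 T, IsTorusImmersion (F t)
  evolution : ∀ t ∈ Ioo 0 T, ∀ u v, HasDerivAt (fun s => F s u v)
    ((h (F t) - meanCurvature (F t) u v) • unitNormal (F t) u v) t
  initial : ∀ u v, F 0 u v = X₀ u v

/-- The volume preserving mean curvature flow starting at `X₀`. -/
def IsVPMCF (X₀ : ℝ → ℝ → E3) (T : ℝ) (F : ℝ → ℝ → ℝ → E3) : Prop :=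
  IsConstrainedMCF averageMeanCurvature X₀ T F

/-- The area preserving mean curvature flow starting at `X₀`; its global term is required to be
well defined. -/
def IsAPMCF (X₀ : ℝ → ℝ → E3) (T : ℝ) (F : ℝ → ℝ → ℝ → E3) : Prop :=
  IsConstrainedMCF squareMeanCurvatureRatio X₀ T F ∧
    ∀ t ∈ Ioo 0 T, surfaceIntegral (F t) (meanCurvature (F t)) ≠ 0

/-- The parametrization of the torus with elliptic section. -/
def ellipticTorus (u v : ℝ) : E3 :=
  !₂[(3 + 2 * cos u) * cos v, (3 + 2 * cos u) * sin v, √2 * sin u]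

/-- The function `((r - 3) / 2)² + (z / √2)²` of the cylindrical coordinates
`r = √(x² + y²)` and `z`. -/
def ellipseFunction (x : E3) : ℝ :=
  ((√(x 0 ^ 2 + x 1 ^ 2) - 3) / 2) ^ 2 + (x 2 / √2) ^ 2

/-- The surface obtained by rotating the ellipse `((r - 3) / 2)² + (z / √2)² = 1` of the
`(r, z)` half-plane about the `z`-axis. -/
def ellipticTorusSurface : Set E3 := {x | ellipseFunction x = 1}

/-- The domain enclosed by that surface. -/
def ellipticTorusDomain : Set E3 := {x | ellipseFunction x < 1}

/-- The inner equator `u = π`. -/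
def innerEquator : Set E3 := range (fun v => ellipticTorus π v)

end

/-! ### Vector algebra in `ℝ³` -/

/-! On the inner equator `H` starts at zero, so everything rests on the sign of its first time
derivative there. For normal speed `h - H` the variation is `∂ₜH = ΔH + |A|²(H - h)`. At `u = π` the
principal curvatures are `1` and `-1`, so `|A|² = 2`, while `H'' = 1` and `|∂ᵤX|² = 2` give `ΔH =
1/2`. Hence `∂ₜH = 1/2 - 2h`, which is negative exactly when `h > 1/4`.

The general variation formula is not derived. Instead `H = Q / |∂ᵥX × ∂ᵤX|³` with `Q` a polynomial
in the first and second derivatives of `X` (`IsTorusImmersion.meanCurvature_eq`), and `Q` has the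
sign of `H`. The initial velocity is again rotationally symmetric, so `∂ₜQ = √2 (1 - 4h)` at `u = π`
becomes a computation with profile functions (`hasDerivWithinAt_curvatureNumerator_ellipticTorus`).

The bound `h > 1/4` follows from `∫ H dμ ≥ 6√2 π²` and `∫ dμ ≤ 24π²`, which make the average at
least `√2/4`; the inequality `∫ (H - c)² dμ ≥ 0` carries it over to `∫ H² / ∫ H`.

The equation is assumed only for `t > 0`, so it is extended to `t = 0` by continuity of the global
term and of the geometry, using one-sided derivatives on `[0, T) × ℝ²`. Compactness of the equator
makes the time of negativity uniform in `v` (`eventually_neg_of_slabDeriv_neg`). -/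

theorem inner_E3 (a b : E3) : inner ℝ a b = a 0 * b 0 + a 1 * b 1 + a 2 * b 2 := by
  simp only [PiLp.inner_apply, Fin.sum_univ_three, RCLike.inner_apply, conj_trivial]
  ring

theorem cross_apply_zero (a b : E3) : cross a b 0 = a 1 * b 2 - a 2 * b 1 := by
  simp [cross, cross_apply]

theorem cross_apply_one (a b : E3) : cross a b 1 = a 2 * b 0 - a 0 * b 2 := by
  simp [cross, cross_apply]

theorem cross_apply_two (a b : E3) : cross a b 2 = a 0 * b 1 - a 1 * b 0 := by
  simp [cross, cross_apply]

/-- Lagrange's identity, in the form that identifies `det g` with the squared length of the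
unnormalized normal. -/
theorem norm_sq_cross (a b : E3) :
    ‖cross b a‖ ^ 2 = inner ℝ a a * inner ℝ b b - inner ℝ a b * inner ℝ b a := by
  rw [← real_inner_self_eq_norm_sq]
  simp only [inner_E3, cross_apply_zero, cross_apply_one, cross_apply_two]
  ring

theorem inner_cross_left (a b : E3) : inner ℝ (cross a b) a = 0 := by
  simp only [inner_E3, cross_apply_zero, cross_apply_one, cross_apply_two]
  ring

theorem inner_cross_right (a b : E3) : inner ℝ (cross a b) b = 0 := by
  simp only [inner_E3, cross_apply_zero, cross_apply_one, cross_apply_two]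
  ring

theorem linearIndependent_pair_iff_cross_ne_zero (a b : E3) :
    LinearIndependent ℝ ![a, b] ↔ cross b a ≠ 0 := by
  have h1 : cross b a ≠ 0 ↔ crossProduct a.ofLp b.ofLp ≠ 0 := by
    rw [cross, Ne, Ne, WithLp.toLp_eq_zero, ← cross_anticomm, neg_eq_zero]
  rw [h1, crossProduct_ne_zero_iff_linearIndependent,
    ← (WithLp.linearEquiv 2 ℝ (Fin 3 → ℝ)).toLinearMap.linearIndependent_iff
      (LinearEquiv.ker _)]
  congr! 1
  ext i
  fin_cases i <;> rfl

theorem ContDiffOn.cross {E : Type*} [NormedAddCommGroup E] [NormedSpace ℝ E] {n : WithTop ℕ∞}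
    {f g : E → E3} {s : Set E} (hf : ContDiffOn ℝ n f s) (hg : ContDiffOn ℝ n g s) :
    ContDiffOn ℝ n (fun x => cross (f x) (g x)) s := by
  rw [contDiffOn_euclidean] at *
  intro i
  fin_cases i
  · simp only [Fin.zero_eta, cross_apply_zero]
    exact ((hf 1).mul (hg 2)).sub ((hf 2).mul (hg 1))
  · simp only [Fin.mk_one, cross_apply_one]
    exact ((hf 2).mul (hg 0)).sub ((hf 0).mul (hg 2))
  · simp only [Fin.reduceFinMk, cross_apply_two]
    exact ((hf 0).mul (hg 1)).sub ((hf 1).mul (hg 0))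

theorem hasDerivWithinAt_E3 {f : ℝ → E3} {f' : E3} {s : Set ℝ} {x : ℝ} :
    HasDerivWithinAt f f' s x ↔ ∀ i, HasDerivWithinAt (fun y => f y i) (f' i) s x := by
  rw [hasDerivWithinAt_iff_hasFDerivWithinAt, hasFDerivWithinAt_euclidean]
  refine forall_congr' fun i => ?_
  rw [hasDerivWithinAt_iff_hasFDerivWithinAt]
  congr! 1

theorem hasDerivAt_E3 {f : ℝ → E3} {f' : E3} {x : ℝ} :
    HasDerivAt f f' x ↔ ∀ i, HasDerivAt (fun y => f y i) (f' i) x := by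
  simp only [← hasDerivWithinAt_univ, hasDerivWithinAt_E3]

theorem HasDerivWithinAt.cross {f g : ℝ → E3} {f' g' : E3} {s : Set ℝ} {x : ℝ}
    (hf : HasDerivWithinAt f f' s x) (hg : HasDerivWithinAt g g' s x) :
    HasDerivWithinAt (fun y => cross (f y) (g y)) (cross f' (g x) + cross (f x) g') s x := by
  rw [hasDerivWithinAt_E3] at *
  intro i
  fin_cases i
  · simp only [Fin.zero_eta, PiLp.add_apply, cross_apply_zero]
    exact (((hf 1).mul (hg 2)).sub ((hf 2).mul (hg 1))).congr_deriv (by ring)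
  · simp only [Fin.mk_one, PiLp.add_apply, cross_apply_one]
    exact (((hf 2).mul (hg 0)).sub ((hf 0).mul (hg 2))).congr_deriv (by ring)
  · simp only [Fin.reduceFinMk, PiLp.add_apply, cross_apply_two]
    exact (((hf 0).mul (hg 1)).sub ((hf 1).mul (hg 0))).congr_deriv (by ring)

/-! ### Smoothness of partial derivatives -/

section Partial

variable {X : ℝ → ℝ → E3}

theorem hasDerivAt_du (hX : ContDiff ℝ ∞ (fun p : ℝ × ℝ => X p.1 p.2)) (u v : ℝ) :
    HasDerivAt (fun s => X s v) (du X u v) u := by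
  have h : DifferentiableAt ℝ ((fun p : ℝ × ℝ => X p.1 p.2) ∘ fun s : ℝ => (s, v)) u :=
    ((hX.differentiable (by simp)) _).comp u (by fun_prop)
  exact h.hasDerivAt

theorem hasDerivAt_dv (hX : ContDiff ℝ ∞ (fun p : ℝ × ℝ => X p.1 p.2)) (u v : ℝ) :
    HasDerivAt (fun s => X u s) (dv X u v) v := by
  have h : DifferentiableAt ℝ ((fun p : ℝ × ℝ => X p.1 p.2) ∘ fun s : ℝ => (u, s)) v :=
    ((hX.differentiable (by simp)) _).comp v (by fun_prop)
  exact h.hasDerivAt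

theorem contDiff_du (hX : ContDiff ℝ ∞ (fun p : ℝ × ℝ => X p.1 p.2)) :
    ContDiff ℝ ∞ (fun p : ℝ × ℝ => du X p.1 p.2) := by
  have h : (fun p : ℝ × ℝ => du X p.1 p.2)
      = fun p => fderiv ℝ (fun p : ℝ × ℝ => X p.1 p.2) p (1, 0) := by
    funext p
    refine HasDerivAt.deriv ?_
    exact ((hX.differentiable (by simp)) p).hasFDerivAt.comp_hasDerivAt p.1
      ((hasDerivAt_id p.1).prodMk (hasDerivAt_const p.1 p.2))
  rw [h]
  exact (hX.fderiv_right (m := ∞) (by simp)).clm_apply contDiff_const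

theorem contDiff_dv (hX : ContDiff ℝ ∞ (fun p : ℝ × ℝ => X p.1 p.2)) :
    ContDiff ℝ ∞ (fun p : ℝ × ℝ => dv X p.1 p.2) := by
  have h : (fun p : ℝ × ℝ => dv X p.1 p.2)
      = fun p => fderiv ℝ (fun p : ℝ × ℝ => X p.1 p.2) p (0, 1) := by
    funext p
    refine HasDerivAt.deriv ?_
    exact ((hX.differentiable (by simp)) p).hasFDerivAt.comp_hasDerivAt p.2
      ((hasDerivAt_const p.2 p.1).prodMk (hasDerivAt_id p.2))
  rw [h]
  exact (hX.fderiv_right (m := ∞) (by simp)).clm_apply contDiff_const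

end Partial

/-! ### The mean curvature in terms of derivatives of the parametrization -/

/-- The numerator of the mean curvature as a polynomial in the first derivatives `a = ∂ᵤX`,
`b = ∂ᵥX` and the second derivatives `p = ∂ᵤ∂ᵤX`, `q = ∂ᵤ∂ᵥX`, `q' = ∂ᵥ∂ᵤX`, `r = ∂ᵥ∂ᵥX`. -/
noncomputable def curvatureNumerator (a b p q q' r : E3) : ℝ :=
  inner ℝ a b * (inner ℝ (cross b a) q + inner ℝ (cross b a) q')
    - inner ℝ b b * inner ℝ (cross b a) p - inner ℝ a a * inner ℝ (cross b a) r

/-- `curvatureNumerator` evaluated on the derivatives of `X`. -/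
noncomputable def meanCurvatureNumerator (X : ℝ → ℝ → E3) (u v : ℝ) : ℝ :=
  curvatureNumerator (du X u v) (dv X u v) (du (du X) u v) (du (dv X) u v) (dv (du X) u v)
    (dv (dv X) u v)

section MeanCurvature

variable {X : ℝ → ℝ → E3}

theorem IsTorusImmersion.cross_ne_zero (hX : IsTorusImmersion X) (u v : ℝ) :
    cross (dv X u v) (du X u v) ≠ 0 :=
  (linearIndependent_pair_iff_cross_ne_zero _ _).1 (hX.immersive u v)

theorem det_firstFundamentalForm (X : ℝ → ℝ → E3) (u v : ℝ) :
    (firstFundamentalForm X u v).det = ‖cross (dv X u v) (du X u v)‖ ^ 2 := by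
  rw [firstFundamentalForm, Matrix.det_fin_two_of, norm_sq_cross]

theorem sqrt_det_firstFundamentalForm (X : ℝ → ℝ → E3) (u v : ℝ) :
    √(firstFundamentalForm X u v).det = ‖cross (dv X u v) (du X u v)‖ := by
  rw [det_firstFundamentalForm, Real.sqrt_sq (norm_nonneg _)]

theorem IsTorusImmersion.contDiff_unitNormal (hX : IsTorusImmersion X) :
    ContDiff ℝ ∞ (fun p : ℝ × ℝ => unitNormal X p.1 p.2) := by
  have hc : ContDiff ℝ ∞ (fun p : ℝ × ℝ => cross (dv X p.1 p.2) (du X p.1 p.2)) :=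
    contDiffOn_univ.1
      ((contDiff_dv hX.smooth).contDiffOn.cross (contDiff_du hX.smooth).contDiffOn)
  exact ((hc.norm ℝ fun p => hX.cross_ne_zero _ _).inv fun p =>
    norm_ne_zero_iff.2 (hX.cross_ne_zero _ _)).smul hc

theorem inner_deriv_eq_neg_of_inner_eq_zero {f g : ℝ → E3} {f' g' : E3} {x : ℝ}
    (hf : HasDerivAt f f' x) (hg : HasDerivAt g g' x) (h : ∀ y, inner ℝ (f y) (g y) = 0) :
    inner ℝ f' (g x) = -inner ℝ (f x) g' := by
  have h1 := hf.inner ℝ hg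
  simp only [h] at h1
  have := h1.unique (hasDerivAt_const x (0 : ℝ))
  linarith

theorem inner_unitNormal_du (X : ℝ → ℝ → E3) (u v : ℝ) :
    inner ℝ (unitNormal X u v) (du X u v) = 0 := by
  rw [unitNormal, inner_smul_left, inner_cross_right, mul_zero]

theorem inner_unitNormal_dv (X : ℝ → ℝ → E3) (u v : ℝ) :
    inner ℝ (unitNormal X u v) (dv X u v) = 0 := by
  rw [unitNormal, inner_smul_left, inner_cross_left, mul_zero]

/-- Differentiating `⟨N, ∂ⱼX⟩ = 0` gives `h_ij = -⟨N, ∂ᵢ∂ⱼX⟩`, so no derivative of `N` remains. The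
adjugate formula for `g⁻¹` contributes `|∂ᵥX × ∂ᵤX|²` to the denominator and the normalization of
`N` one more factor. The two mixed derivatives stay separate, so their equality is not needed. -/
theorem IsTorusImmersion.meanCurvature_eq (hX : IsTorusImmersion X) (u v : ℝ) :
    meanCurvature X u v
      = meanCurvatureNumerator X u v / ‖cross (dv X u v) (du X u v)‖ ^ 3 := by
  have hN := hX.contDiff_unitNormal
  have hdu := contDiff_du hX.smooth
  have hdv := contDiff_dv hX.smooth
  have h11 := inner_deriv_eq_neg_of_inner_eq_zero (hasDerivAt_du hN u v) (hasDerivAt_du hdu u v)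
    fun y => inner_unitNormal_du X y v
  have h12 := inner_deriv_eq_neg_of_inner_eq_zero (hasDerivAt_du hN u v) (hasDerivAt_du hdv u v)
    fun y => inner_unitNormal_dv X y v
  have h21 := inner_deriv_eq_neg_of_inner_eq_zero (hasDerivAt_dv hN u v) (hasDerivAt_dv hdu u v)
    fun y => inner_unitNormal_du X u y
  have h22 := inner_deriv_eq_neg_of_inner_eq_zero (hasDerivAt_dv hN u v) (hasDerivAt_dv hdv u v)
    fun y => inner_unitNormal_dv X u y
  have hpos : ‖cross (dv X u v) (du X u v)‖ ≠ 0 := norm_ne_zero_iff.2 (hX.cross_ne_zero u v)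
  have hdet := det_firstFundamentalForm X u v
  rw [meanCurvature, shapeOperator, Matrix.inv_def, hdet, firstFundamentalForm,
    secondFundamentalForm, h11, h12, h21, h22, Matrix.adjugate_fin_two_of, Ring.inverse_eq_inv',
    meanCurvatureNumerator, curvatureNumerator]
  simp only [unitNormal, inner_smul_left, conj_trivial, Matrix.trace_fin_two, Matrix.smul_mul,
    Matrix.smul_apply, Matrix.mul_apply, Fin.sum_univ_two, Matrix.of_apply, Matrix.cons_val',
    Matrix.cons_val_zero, Matrix.cons_val_one, Matrix.cons_val_fin_one, smul_eq_mul]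
  rw [real_inner_comm (du X u v) (dv X u v)]
  field_simp
  ring

/-- Allows the flow argument to differentiate a polynomial expression instead of a quotient with
norms. -/
theorem IsTorusImmersion.meanCurvature_neg_iff (hX : IsTorusImmersion X) (u v : ℝ) :
    meanCurvature X u v < 0 ↔ meanCurvatureNumerator X u v < 0 := by
  have hpos : 0 < ‖cross (dv X u v) (du X u v)‖ ^ 3 :=
    pow_pos (norm_pos_iff.2 (hX.cross_ne_zero u v)) 3
  rw [hX.meanCurvature_eq, div_lt_iff₀ hpos, zero_mul]

theorem IsTorusImmersion.continuous_meanCurvature (hX : IsTorusImmersion X) :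
    Continuous (fun p : ℝ × ℝ => meanCurvature X p.1 p.2) := by
  have hN := hX.contDiff_unitNormal
  have hdu := (contDiff_du hX.smooth)
  have hdv := (contDiff_dv hX.smooth)
  have hc : Continuous (fun p : ℝ × ℝ => cross (dv X p.1 p.2) (du X p.1 p.2)) :=
    (contDiffOn_univ.1 (hdv.contDiffOn.cross hdu.contDiffOn)).continuous
  have h1 := hdu.continuous
  have h2 := hdv.continuous
  have h11 := (contDiff_du hdu).continuous
  have h12 := (contDiff_du hdv).continuous
  have h21 := (contDiff_dv hdu).continuous
  have h22 := (contDiff_dv hdv).continuous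
  simp only [hX.meanCurvature_eq, meanCurvatureNumerator, curvatureNumerator]
  refine Continuous.div ?_ (by fun_prop) fun p =>
    pow_ne_zero 3 (norm_ne_zero_iff.2 (hX.cross_ne_zero _ _))
  exact (((h1.inner h2).mul ((hc.inner h12).add (hc.inner h21))).sub
    ((h2.inner h2).mul (hc.inner h11))).sub ((h1.inner h1).mul (hc.inner h22))

end MeanCurvature

/-! ### Periodicity -/

section Periodic

variable {X : ℝ → ℝ → E3} {c : ℝ}

theorem du_add_left (h : ∀ u v, X (u + c) v = X u v) (u v : ℝ) :
    du X (u + c) v = du X u v := by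
  simp only [du, ← deriv_comp_add_const, h]

theorem dv_add_left (h : ∀ u v, X (u + c) v = X u v) (u v : ℝ) :
    dv X (u + c) v = dv X u v := by
  simp only [dv, h]

theorem du_add_right (h : ∀ u v, X u (v + c) = X u v) (u v : ℝ) :
    du X u (v + c) = du X u v := by
  simp only [du, h]

theorem dv_add_right (h : ∀ u v, X u (v + c) = X u v) (u v : ℝ) :
    dv X u (v + c) = dv X u v := by
  simp only [dv, ← deriv_comp_add_const, h]

theorem meanCurvature_add_left (h : ∀ u v, X (u + c) v = X u v) (u v : ℝ) :
    meanCurvature X (u + c) v = meanCurvature X u v := by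
  have hN : ∀ u v, unitNormal X (u + c) v = unitNormal X u v := fun u v => by
    simp only [unitNormal, du_add_left h, dv_add_left h]
  simp only [meanCurvature, shapeOperator, firstFundamentalForm, secondFundamentalForm,
    du_add_left h, dv_add_left h, du_add_left hN, dv_add_left hN]

theorem meanCurvature_add_right (h : ∀ u v, X u (v + c) = X u v) (u v : ℝ) :
    meanCurvature X u (v + c) = meanCurvature X u v := by
  have hN : ∀ u v, unitNormal X u (v + c) = unitNormal X u v := fun u v => by
    simp only [unitNormal, du_add_right h, dv_add_right h]
  simp only [meanCurvature, shapeOperator, firstFundamentalForm, secondFundamentalForm,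
    du_add_right h, dv_add_right h, du_add_right hN, dv_add_right hN]

end Periodic

/-- Periodicity reduces to a compact square. Boundedness matters because a real `⨅` over a family
unbounded below is `0` by convention. -/
theorem IsTorusImmersion.bddBelow_meanCurvature {X : ℝ → ℝ → E3} (hX : IsTorusImmersion X) :
    BddBelow (range fun p : ℝ × ℝ => meanCurvature X p.1 p.2) := by
  have hK : IsCompact (Icc (0 : ℝ) (2 * π) ×ˢ Icc (0 : ℝ) (2 * π)) :=
    isCompact_Icc.prod isCompact_Icc
  obtain ⟨m, hm⟩ := hK.bddBelow_image hX.continuous_meanCurvature.continuousOn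
  refine ⟨m, ?_⟩
  rintro _ ⟨⟨u, v⟩, rfl⟩
  obtain ⟨u', hu', hu⟩ := Function.Periodic.exists_mem_Ico₀ (f := fun u => meanCurvature X u v)
    (fun u => meanCurvature_add_left hX.periodic_u u v) two_pi_pos u
  obtain ⟨v', hv', hv⟩ := Function.Periodic.exists_mem_Ico₀ (f := fun v => meanCurvature X u' v)
    (fun v => meanCurvature_add_right hX.periodic_v u' v) two_pi_pos v
  refine hm ⟨(u', v'), ⟨Ico_subset_Icc_self hu', Ico_subset_Icc_self hv'⟩, ?_⟩
  dsimp only at hu hv ⊢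
  rw [hu, hv]

/-! ### Surfaces of revolution -/

/-- The surface of revolution about the third axis with profile curve `(a, b)`. -/
noncomputable def revolve (a b : ℝ → ℝ) (u v : ℝ) : E3 := !₂[a u * cos v, a u * sin v, b u]

/-- The field `a • e_v` along a surface of revolution, with `e_v` the unit rotation field. -/
noncomputable def rotationField (a : ℝ → ℝ) (u v : ℝ) : E3 := !₂[-(a u * sin v), a u * cos v, 0]

section Revolve

variable {a b : ℝ → ℝ}

@[simp] theorem revolve_zero (u v : ℝ) : revolve a b u v 0 = a u * cos v := rfl
@[simp] theorem revolve_one (u v : ℝ) : revolve a b u v 1 = a u * sin v := rfl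
@[simp] theorem revolve_two (u v : ℝ) : revolve a b u v 2 = b u := rfl
@[simp] theorem rotationField_zero (u v : ℝ) : rotationField a u v 0 = -(a u * sin v) := rfl
@[simp] theorem rotationField_one (u v : ℝ) : rotationField a u v 1 = a u * cos v := rfl
@[simp] theorem rotationField_two (u v : ℝ) : rotationField a u v 2 = 0 := rfl

/-- The fields `revolve` and `rotationField` are mutually orthogonal and together closed under both
partial derivatives, so every derivative of a surface of revolution reduces to operations on profile
functions. -/
theorem du_revolve (ha : Differentiable ℝ a) (hb : Differentiable ℝ b) :
    du (revolve a b) = revolve (deriv a) (deriv b) := by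
  funext u v
  refine HasDerivAt.deriv (hasDerivAt_E3.2 fun i => ?_)
  fin_cases i
  · exact (ha u).hasDerivAt.mul_const (cos v)
  · exact (ha u).hasDerivAt.mul_const (sin v)
  · exact (hb u).hasDerivAt

theorem dv_revolve (a b : ℝ → ℝ) : dv (revolve a b) = rotationField a := by
  funext u v
  refine HasDerivAt.deriv (hasDerivAt_E3.2 fun i => ?_)
  fin_cases i
  · exact ((hasDerivAt_cos v).const_mul (a u)).congr_deriv (by simp)
  · exact (hasDerivAt_sin v).const_mul (a u)
  · exact hasDerivAt_const v (b u)

theorem du_rotationField (ha : Differentiable ℝ a) :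
    du (rotationField a) = rotationField (deriv a) := by
  funext u v
  refine HasDerivAt.deriv (hasDerivAt_E3.2 fun i => ?_)
  fin_cases i
  · exact ((ha u).hasDerivAt.mul_const (sin v)).neg
  · exact (ha u).hasDerivAt.mul_const (cos v)
  · exact hasDerivAt_const u (0 : ℝ)

theorem dv_rotationField (a : ℝ → ℝ) :
    dv (rotationField a) = revolve (fun u => -a u) (fun _ => 0) := by
  funext u v
  refine HasDerivAt.deriv (hasDerivAt_E3.2 fun i => ?_)
  fin_cases i
  · exact ((hasDerivAt_sin v).const_mul (a u)).neg.congr_deriv (by simp)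
  · exact ((hasDerivAt_cos v).const_mul (a u)).congr_deriv (by simp)
  · exact hasDerivAt_const v (0 : ℝ)

@[simp] theorem inner_revolve_revolve (a b a' b' : ℝ → ℝ) (u v : ℝ) :
    inner ℝ (revolve a b u v) (revolve a' b' u v) = a u * a' u + b u * b' u := by
  simp only [inner_E3, revolve_zero, revolve_one, revolve_two]
  linear_combination a u * a' u * sin_sq_add_cos_sq v

@[simp] theorem inner_revolve_rotationField (a b a' : ℝ → ℝ) (u v : ℝ) :
    inner ℝ (revolve a b u v) (rotationField a' u v) = 0 := by
  simp only [inner_E3, revolve_zero, revolve_one, revolve_two, rotationField_zero,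
    rotationField_one, rotationField_two]
  ring

@[simp] theorem inner_rotationField_rotationField (a a' : ℝ → ℝ) (u v : ℝ) :
    inner ℝ (rotationField a u v) (rotationField a' u v) = a u * a' u := by
  simp only [inner_E3, rotationField_zero, rotationField_one, rotationField_two]
  linear_combination a u * a' u * sin_sq_add_cos_sq v

theorem cross_rotationField_revolve (a a' b' : ℝ → ℝ) (u v : ℝ) :
    cross (rotationField a u v) (revolve a' b' u v)
      = revolve (fun u => a u * b' u) (fun u => -(a u * a' u)) u v := by
  ext i
  fin_cases i
  · simp only [Fin.zero_eta, cross_apply_zero, revolve_zero, revolve_two, rotationField_one,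
      revolve_one, rotationField_two]
    ring
  · simp only [Fin.mk_one, cross_apply_one, revolve_zero, revolve_two, rotationField_zero,
      revolve_one, rotationField_two]
    ring
  · simp only [Fin.reduceFinMk, cross_apply_two, revolve_zero, revolve_two, rotationField_zero,
      revolve_one, rotationField_one]
    linear_combination -(a u * a' u) * sin_sq_add_cos_sq v

theorem contDiff_revolve (ha : ContDiff ℝ ∞ a) (hb : ContDiff ℝ ∞ b) :
    ContDiff ℝ ∞ (fun p : ℝ × ℝ => revolve a b p.1 p.2) := by
  refine contDiff_euclidean.2 fun i => ?_
  fin_cases i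
  · exact (ha.comp contDiff_fst).mul (contDiff_cos.comp contDiff_snd)
  · exact (ha.comp contDiff_fst).mul (contDiff_sin.comp contDiff_snd)
  · exact hb.comp contDiff_fst

end Revolve

/-! ### The elliptic torus -/

/-- The speed of the parametrized ellipse. -/
noncomputable def ellipseSpeed (u : ℝ) : ℝ := √(4 - 2 * cos u ^ 2)

theorem ellipseSpeed_sq (u : ℝ) : ellipseSpeed u ^ 2 = 4 - 2 * cos u ^ 2 :=
  Real.sq_sqrt (by nlinarith [cos_sq_le_one u])

theorem ellipseSpeed_pos (u : ℝ) : 0 < ellipseSpeed u :=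
  Real.sqrt_pos.2 (by nlinarith [cos_sq_le_one u])

theorem sqrt_two_sq : √(2 : ℝ) ^ 2 = 2 := Real.sq_sqrt (by norm_num)

theorem radius_pos (u : ℝ) : 0 < 3 + 2 * cos u := by linarith [neg_one_le_cos u]

theorem ellipticTorus_eq_revolve :
    ellipticTorus = revolve (fun u => 3 + 2 * cos u) (fun u => √2 * sin u) := rfl

theorem deriv_radius : deriv (fun u : ℝ => 3 + 2 * cos u) = fun u => -(2 * sin u) := by
  funext u
  exact (((hasDerivAt_cos u).const_mul 2).const_add 3).deriv.trans (by ring)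

theorem deriv_height : deriv (fun u : ℝ => √2 * sin u) = fun u => √2 * cos u := by
  funext u
  exact ((hasDerivAt_sin u).const_mul (√2)).deriv

theorem deriv_deriv_radius : deriv (fun u : ℝ => -(2 * sin u)) = fun u => -(2 * cos u) := by
  funext u
  exact ((hasDerivAt_sin u).const_mul 2).neg.deriv

theorem deriv_deriv_height : deriv (fun u : ℝ => √2 * cos u) = fun u => -(√2 * sin u) := by
  funext u
  exact ((hasDerivAt_cos u).const_mul (√2)).deriv.trans (by ring)

theorem du_ellipticTorus :
    du ellipticTorus = revolve (fun u => -(2 * sin u)) (fun u => √2 * cos u) := by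
  rw [ellipticTorus_eq_revolve, du_revolve (by fun_prop) (by fun_prop), deriv_radius, deriv_height]

theorem dv_ellipticTorus : dv ellipticTorus = rotationField (fun u => 3 + 2 * cos u) := by
  rw [ellipticTorus_eq_revolve, dv_revolve]

theorem du_du_ellipticTorus :
    du (du ellipticTorus) = revolve (fun u => -(2 * cos u)) (fun u => -(√2 * sin u)) := by
  rw [du_ellipticTorus, du_revolve (by fun_prop) (by fun_prop), deriv_deriv_radius,
    deriv_deriv_height]

theorem du_dv_ellipticTorus :
    du (dv ellipticTorus) = rotationField (fun u => -(2 * sin u)) := by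
  rw [dv_ellipticTorus, du_rotationField (by fun_prop), deriv_radius]

theorem dv_du_ellipticTorus :
    dv (du ellipticTorus) = rotationField (fun u => -(2 * sin u)) := by
  rw [du_ellipticTorus, dv_revolve]

theorem dv_dv_ellipticTorus :
    dv (dv ellipticTorus) = revolve (fun u => -(3 + 2 * cos u)) (fun _ => 0) := by
  rw [dv_ellipticTorus, dv_rotationField]

theorem cross_ellipticTorus (u v : ℝ) :
    cross (dv ellipticTorus u v) (du ellipticTorus u v)
      = (3 + 2 * cos u) • revolve (fun u => √2 * cos u) (fun u => 2 * sin u) u v := by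
  rw [dv_ellipticTorus, du_ellipticTorus, cross_rotationField_revolve]
  ext i
  fin_cases i <;> simp <;> ring

theorem norm_cross_ellipticTorus (u v : ℝ) :
    ‖cross (dv ellipticTorus u v) (du ellipticTorus u v)‖
      = (3 + 2 * cos u) * ellipseSpeed u := by
  have h : ‖revolve (fun u => √2 * cos u) (fun u => 2 * sin u) u v‖ = ellipseSpeed u := by
    rw [← sq_eq_sq₀ (norm_nonneg _) (ellipseSpeed_pos u).le, ellipseSpeed_sq,
      ← real_inner_self_eq_norm_sq, inner_revolve_revolve]
    linear_combination 4 * sin_sq_add_cos_sq u + cos u ^ 2 * sqrt_two_sq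
  rw [cross_ellipticTorus, norm_smul, h, Real.norm_of_nonneg (radius_pos u).le]

theorem isTorusEmbedding_ellipticTorus : IsTorusEmbedding ellipticTorus where
  smooth := by
    rw [ellipticTorus_eq_revolve]
    exact contDiff_revolve (by fun_prop) (by fun_prop)
  periodic_u u v := by simp [ellipticTorus]
  periodic_v u v := by simp [ellipticTorus]
  immersive u v := by
    rw [linearIndependent_pair_iff_cross_ne_zero, ← norm_ne_zero_iff, norm_cross_ellipticTorus]
    exact (mul_pos (radius_pos u) (ellipseSpeed_pos u)).ne'
  injective u v u' v' h := by
    have h0 : (3 + 2 * cos u) * cos v = (3 + 2 * cos u') * cos v' := congrArg (fun x : E3 => x 0) h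
    have h1 : (3 + 2 * cos u) * sin v = (3 + 2 * cos u') * sin v' := congrArg (fun x : E3 => x 1) h
    have h2 : √2 * sin u = √2 * sin u' := congrArg (fun x : E3 => x 2) h
    -- The squares of the first two coordinates add up to the squared distance from the axis, and
    -- both distances are positive.
    have hr : 3 + 2 * cos u = 3 + 2 * cos u' := by
      rw [← sq_eq_sq₀ (radius_pos u).le (radius_pos u').le]
      linear_combination ((3 + 2 * cos u) * cos v + (3 + 2 * cos u') * cos v') * h0
        + ((3 + 2 * cos u) * sin v + (3 + 2 * cos u') * sin v') * h1
        - (3 + 2 * cos u) ^ 2 * sin_sq_add_cos_sq v + (3 + 2 * cos u') ^ 2 * sin_sq_add_cos_sq v'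
    have hsin : sin u = sin u' := mul_left_cancel₀ (by positivity) h2
    rw [← hr] at h0 h1
    have key : ∀ x y : ℝ, cos x = cos y → sin x = sin y → ∃ m : ℤ, y = x + m * (2 * π) := by
      intro x y hc hs
      obtain ⟨m, hm⟩ := Real.Angle.angle_eq_iff_two_pi_dvd_sub.1 (Real.Angle.cos_sin_inj hc hs)
      exact ⟨-m, by push_cast; linarith⟩
    obtain ⟨m, hm⟩ := key u u' (by linarith) hsin
    obtain ⟨n, hn⟩ := key v v' (mul_left_cancel₀ (radius_pos u).ne' h0)
      (mul_left_cancel₀ (radius_pos u).ne' h1)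
    exact ⟨m, n, hm, hn⟩

/-! ### The torus as a level set, and its outward normal -/

theorem exists_polar (x y : ℝ) :
    ∃ θ : ℝ, x = √(x ^ 2 + y ^ 2) * cos θ ∧ y = √(x ^ 2 + y ^ 2) * sin θ := by
  have h : ‖(⟨x, y⟩ : ℂ)‖ = √(x ^ 2 + y ^ 2) := by
    rw [Complex.norm_def, Complex.normSq_mk, sq, sq]
  refine ⟨Complex.arg ⟨x, y⟩, ?_, ?_⟩
  · rw [← h, Complex.norm_mul_cos_arg]
  · rw [← h, Complex.norm_mul_sin_arg]

theorem sqrt_sq_add_sq_polar {r : ℝ} (hr : 0 ≤ r) (v : ℝ) :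
    √((r * cos v) ^ 2 + (r * sin v) ^ 2) = r := by
  rw [← Real.sqrt_sq hr]
  congr 1
  rw [Real.sqrt_sq hr]
  linear_combination r ^ 2 * sin_sq_add_cos_sq v

theorem ellipseFunction_revolve {a b : ℝ → ℝ} {u : ℝ} (ha : 0 ≤ a u) (v : ℝ) :
    ellipseFunction (revolve a b u v) = ((a u - 3) / 2) ^ 2 + b u ^ 2 / 2 := by
  rw [ellipseFunction, revolve_zero, revolve_one, revolve_two, sqrt_sq_add_sq_polar ha, div_pow _ √2,
    sqrt_two_sq]

theorem range_ellipticTorus :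
    range (fun p : ℝ × ℝ => ellipticTorus p.1 p.2) = ellipticTorusSurface := by
  ext x
  constructor
  · rintro ⟨⟨u, v⟩, rfl⟩
    rw [ellipticTorusSurface, mem_ofPred_eq, ellipticTorus_eq_revolve]
    dsimp only
    rw [ellipseFunction_revolve (a := fun u => 3 + 2 * cos u) (radius_pos u).le]
    linear_combination sin_sq_add_cos_sq u + sin u ^ 2 / 2 * sqrt_two_sq
  · intro hx
    obtain ⟨v, hv0, hv1⟩ := exists_polar (x 0) (x 1)
    -- Polar coordinates in the normalized `(r, z)` plane; by `hx` the polar radius is `1`, so the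
    -- angle is the ellipse parameter.
    obtain ⟨u, hu0, hu1⟩ := exists_polar ((√(x 0 ^ 2 + x 1 ^ 2) - 3) / 2) (x 2 / √2)
    rw [ellipticTorusSurface, mem_ofPred_eq, ellipseFunction] at hx
    rw [hx, Real.sqrt_one, one_mul] at hu0 hu1
    have hr : √(x 0 ^ 2 + x 1 ^ 2) = 3 + 2 * cos u := by linarith
    rw [hr] at hv0 hv1
    refine ⟨(u, v), ?_⟩
    ext i
    fin_cases i
    · exact hv0.symm
    · exact hv1.symm
    · have : x 2 = √2 * sin u := by rw [← hu1]; field_simp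
      exact this.symm

theorem unitNormal_ellipticTorus :
    unitNormal ellipticTorus
      = revolve (fun u => √2 * cos u / ellipseSpeed u) (fun u => 2 * sin u / ellipseSpeed u) := by
  funext u v
  have hr := (radius_pos u).ne'
  have hw := (ellipseSpeed_pos u).ne'
  rw [unitNormal, norm_cross_ellipticTorus, cross_ellipticTorus]
  ext i
  fin_cases i <;> simp <;> field_simp

theorem continuous_ellipseFunction : Continuous ellipseFunction := by
  unfold ellipseFunction
  fun_prop

theorem closure_ellipticTorusDomain_subset :
    closure ellipticTorusDomain ⊆ {x | ellipseFunction x ≤ 1} :=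
  closure_minimal (fun _ hx => le_of_lt (mem_ofPred_eq.mp hx))
    (isClosed_le continuous_ellipseFunction continuous_const)

theorem ellipticTorus_add_smul_unitNormal (u v s : ℝ) :
    ellipticTorus u v + s • unitNormal ellipticTorus u v
      = revolve (fun u => 3 + 2 * cos u + s * (√2 * cos u / ellipseSpeed u))
          (fun u => √2 * sin u + s * (2 * sin u / ellipseSpeed u)) u v := by
  rw [unitNormal_ellipticTorus, ellipticTorus_eq_revolve]
  ext i
  fin_cases i <;> simp <;> ring

/-- While the displaced radius stays positive the square root in `ellipseFunction` disappears and
the value is an exact quadratic in `s`. Its linear coefficient is positive, which decides inside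
from outside for both signs of small `s`. -/
theorem eventually_ellipseFunction_eq (u v : ℝ) :
    ∀ᶠ s in 𝓝 (0 : ℝ), ellipseFunction (ellipticTorus u v + s • unitNormal ellipticTorus u v)
      = 1 + s * (√2 * (1 + sin u ^ 2) / ellipseSpeed u
        + s * ((cos u ^ 2 / 2 + 2 * sin u ^ 2) / ellipseSpeed u ^ 2)) := by
  have hc : ContinuousAt (fun s => 3 + 2 * cos u + s * (√2 * cos u / ellipseSpeed u)) 0 := by
    fun_prop
  have hpos : ∀ᶠ s in 𝓝 (0 : ℝ), 0 < 3 + 2 * cos u + s * (√2 * cos u / ellipseSpeed u) :=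
    hc.eventually (lt_mem_nhds (by simpa using radius_pos u))
  filter_upwards [hpos] with s hs
  rw [ellipticTorus_add_smul_unitNormal, ellipseFunction_revolve
    (a := fun u => 3 + 2 * cos u + s * (√2 * cos u / ellipseSpeed u)) hs.le]
  linear_combination (1 + √2 * (s / ellipseSpeed u)) * sin_sq_add_cos_sq u
    + (cos u ^ 2 * (s / ellipseSpeed u) ^ 2 / 4 + sin u ^ 2 / 2) * sqrt_two_sq

theorem eventually_inside_and_outside (u v : ℝ) : ∀ᶠ s in 𝓝[>] (0 : ℝ),
    ellipticTorus u v - s • unitNormal ellipticTorus u v ∈ ellipticTorusDomain ∧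
      ellipticTorus u v + s • unitNormal ellipticTorus u v ∉ closure ellipticTorusDomain := by
  have hw := ellipseSpeed_pos u
  set α := √2 * (1 + sin u ^ 2) / ellipseSpeed u with hα
  set β := (cos u ^ 2 / 2 + 2 * sin u ^ 2) / ellipseSpeed u ^ 2 with hβ
  have hα0 : 0 < α := by positivity
  have h1 := eventually_ellipseFunction_eq u v
  have h2 : ∀ᶠ s in 𝓝 (0 : ℝ),
      ellipseFunction (ellipticTorus u v + (-s) • unitNormal ellipticTorus u v)
      = 1 + (-s) * (α + (-s) * β) :=
    (continuous_neg.tendsto' (0 : ℝ) 0 neg_zero).eventually h1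
  have h3 : ∀ᶠ s in 𝓝 (0 : ℝ), 0 < α + s * β :=
    (show ContinuousAt (fun s => α + s * β) 0 by fun_prop).eventually
      (lt_mem_nhds (by simpa using hα0))
  have h4 : ∀ᶠ s in 𝓝 (0 : ℝ), 0 < α + (-s) * β :=
    (continuous_neg.tendsto' (0 : ℝ) 0 neg_zero).eventually h3
  filter_upwards [nhdsWithin_le_nhds h1, nhdsWithin_le_nhds h2, nhdsWithin_le_nhds h3,
    nhdsWithin_le_nhds h4, self_mem_nhdsWithin] with s h1 h2 h3 h4 (hs : 0 < s)
  constructor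
  · rw [sub_eq_add_neg, ← neg_smul, ellipticTorusDomain, mem_ofPred_eq, h2]
    nlinarith [mul_pos hs h4]
  · intro hmem
    have := closure_ellipticTorusDomain_subset hmem
    rw [mem_ofPred_eq, h1] at this
    nlinarith [mul_pos hs h3]

/-! ### Mean curvature of the elliptic torus -/

/-- With `w = ellipseSpeed u` and `r = 3 + 2 cos u`, the two summands are the principal curvatures
`2√2 / w³` along the meridian and `√2 cos u / (w r)` along the parallel. -/
theorem meanCurvature_ellipticTorus (u v : ℝ) :
    meanCurvature ellipticTorus u v
      = √2 / ellipseSpeed u * (2 / ellipseSpeed u ^ 2 + cos u / (3 + 2 * cos u)) := by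
  have hr := (radius_pos u).ne'
  have hw := (ellipseSpeed_pos u).ne'
  have hnum : meanCurvatureNumerator ellipticTorus u v
      = 2 * √2 * (3 + 2 * cos u) ^ 3 + √2 * cos u * (3 + 2 * cos u) ^ 2 * ellipseSpeed u ^ 2 := by
    rw [meanCurvatureNumerator, curvatureNumerator, cross_ellipticTorus, du_du_ellipticTorus,
      du_dv_ellipticTorus, dv_du_ellipticTorus, dv_dv_ellipticTorus, dv_ellipticTorus,
      du_ellipticTorus, ellipseSpeed_sq]
    simp only [inner_smul_left, inner_revolve_revolve, inner_revolve_rotationField,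
      inner_rotationField_rotationField, conj_trivial]
    linear_combination
      2 * √2 * (3 + 2 * cos u) ^ 3 * sin_sq_add_cos_sq u + √2 * cos u * (3 + 2 * cos u) ^ 2 *
        (4 * sin_sq_add_cos_sq u + cos u ^ 2 * sqrt_two_sq)
  rw [isTorusEmbedding_ellipticTorus.meanCurvature_eq, hnum, norm_cross_ellipticTorus]
  field_simp

theorem mem_innerEquator_iff (u v : ℝ) : ellipticTorus u v ∈ innerEquator ↔ cos u = -1 := by
  constructor
  · rintro ⟨v', h⟩
    obtain ⟨m, n, hm, -⟩ := isTorusEmbedding_ellipticTorus.injective _ _ _ _ h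
    rw [hm, Real.cos_add_int_mul_two_pi, cos_pi]
  · intro h
    have hs : sin u = 0 := by
      have := sin_sq_add_cos_sq u
      rw [h] at this
      nlinarith
    exact ⟨v, by simp [ellipticTorus, h, hs]⟩

theorem meanCurvature_ellipticTorus_eq_zero {u : ℝ} (h : cos u = -1) (v : ℝ) :
    meanCurvature ellipticTorus u v = 0 := by
  rw [meanCurvature_ellipticTorus, ellipseSpeed_sq, h]
  norm_num

theorem meanCurvature_ellipticTorus_pos {u : ℝ} (h : cos u ≠ -1) (v : ℝ) :
    0 < meanCurvature ellipticTorus u v := by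
  have hc : -1 < cos u := lt_of_le_of_ne (neg_one_le_cos u) h.symm
  have hc1 := cos_le_one u
  have hW : 0 < 4 - 2 * cos u ^ 2 := by nlinarith [cos_sq_le_one u]
  have hr := radius_pos u
  rw [meanCurvature_ellipticTorus, ellipseSpeed_sq, div_add_div _ _ hW.ne' hr.ne']
  have hw := ellipseSpeed_pos u
  -- With `c = cos u` the expression factors as `2 (1 + c)(3 + c - c²)`, and the last factor is
  -- positive on `(-1, 1]`.
  have : 0 < 2 * (3 + 2 * cos u) + (4 - 2 * cos u ^ 2) * cos u := by
    nlinarith [mul_pos (show 0 < cos u + 1 by linarith)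
      (show 0 < 3 + cos u - cos u ^ 2 by nlinarith)]
  positivity

/-! ### Integrals over the elliptic torus -/

theorem surfaceIntegral_ellipticTorus (φ : ℝ → ℝ) :
    surfaceIntegral ellipticTorus (fun u _ => φ u)
      = 2 * π * ∫ u in (0 : ℝ)..(2 * π), φ u * ((3 + 2 * cos u) * ellipseSpeed u) := by
  rw [surfaceIntegral, ← intervalIntegral.integral_const_mul]
  refine intervalIntegral.integral_congr fun u _ => ?_
  simp only [sqrt_det_firstFundamentalForm, norm_cross_ellipticTorus,
    intervalIntegral.integral_const, sub_zero, smul_eq_mul]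

/-- The mean curvature of the elliptic torus as a function of the profile parameter. -/
noncomputable def profileMeanCurvature (u : ℝ) : ℝ :=
  √2 / ellipseSpeed u * (2 / ellipseSpeed u ^ 2 + cos u / (3 + 2 * cos u))

theorem meanCurvature_ellipticTorus_eq_profile :
    meanCurvature ellipticTorus = fun u _ => profileMeanCurvature u := by
  funext u v
  exact meanCurvature_ellipticTorus u v

theorem contDiff_ellipseSpeed : ContDiff ℝ ∞ ellipseSpeed :=
  ContDiff.sqrt (by fun_prop) fun u => by nlinarith [cos_sq_le_one u]

theorem contDiff_profileMeanCurvature : ContDiff ℝ ∞ profileMeanCurvature := by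
  have h := contDiff_ellipseSpeed
  exact (contDiff_const.div h fun u => (ellipseSpeed_pos u).ne').mul
    ((contDiff_const.div (h.pow 2) fun u => (pow_pos (ellipseSpeed_pos u) 2).ne').add
      (contDiff_cos.div (by fun_prop) fun u => (radius_pos u).ne'))

theorem integral_const_add_const_mul_cos (a b : ℝ) :
    ∫ u in (0 : ℝ)..(2 * π), (a + b * cos u) = 2 * π * a := by
  rw [intervalIntegral.integral_add (by simp) (Continuous.intervalIntegrable (by fun_prop) _ _),
    intervalIntegral.integral_const_mul, integral_cos]
  simp

theorem ellipseSpeed_le_two (u : ℝ) : ellipseSpeed u ≤ 2 :=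
  Real.sqrt_le_iff.2 ⟨by norm_num, by nlinarith [sq_nonneg (cos u)]⟩

theorem area_ellipticTorus_pos : 0 < surfaceIntegral ellipticTorus (fun _ _ => 1) := by
  rw [surfaceIntegral_ellipticTorus (fun _ => 1)]
  have hw := contDiff_ellipseSpeed.continuous
  refine mul_pos two_pi_pos (intervalIntegral.intervalIntegral_pos_of_pos
    (Continuous.intervalIntegrable (by fun_prop) _ _) (fun u => ?_) two_pi_pos)
  have := radius_pos u
  have := ellipseSpeed_pos u
  positivity

/-- Bound the speed of the ellipse by `2` and integrate `6 + 4 cos u`. -/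
theorem area_ellipticTorus_le : surfaceIntegral ellipticTorus (fun _ _ => 1) ≤ 24 * π ^ 2 := by
  rw [surfaceIntegral_ellipticTorus (fun _ => 1)]
  have hw := contDiff_ellipseSpeed.continuous
  have h : ∫ u in (0 : ℝ)..(2 * π), 1 * ((3 + 2 * cos u) * ellipseSpeed u)
      ≤ ∫ u in (0 : ℝ)..(2 * π), (6 + 4 * cos u) := by
    refine intervalIntegral.integral_mono_on two_pi_pos.le
      (Continuous.intervalIntegrable (by fun_prop) _ _)
      (Continuous.intervalIntegrable (by fun_prop) _ _) fun u _ => ?_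
    nlinarith [mul_nonneg (radius_pos u).le (sub_nonneg.2 (ellipseSpeed_le_two u))]
  rw [integral_const_add_const_mul_cos] at h
  nlinarith [mul_le_mul_of_nonneg_left h two_pi_pos.le]

/-- The density `H w r` equals `√2 (2r / w² + cos u)`, with `w` the ellipse speed and `r` the
radius, and `w² ≤ 4` bounds it below by `√2 (3/2 + 2 cos u)`. -/
theorem totalMeanCurvature_ellipticTorus_ge :
    6 * √2 * π ^ 2 ≤ surfaceIntegral ellipticTorus (meanCurvature ellipticTorus) := by
  rw [meanCurvature_ellipticTorus_eq_profile, surfaceIntegral_ellipticTorus]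
  have hw := contDiff_ellipseSpeed.continuous
  have hH := contDiff_profileMeanCurvature.continuous
  have h : ∫ u in (0 : ℝ)..(2 * π), (√2 * (3 / 2) + (√2 * 2) * cos u)
      ≤ ∫ u in (0 : ℝ)..(2 * π), profileMeanCurvature u * ((3 + 2 * cos u) * ellipseSpeed u) := by
    refine intervalIntegral.integral_mono_on two_pi_pos.le
      (Continuous.intervalIntegrable (by fun_prop) _ _)
      (Continuous.intervalIntegrable (by fun_prop) _ _) fun u _ => ?_
    have hr := radius_pos u
    have hws := ellipseSpeed_pos u
    have hW : 0 < 4 - 2 * cos u ^ 2 := by nlinarith [cos_sq_le_one u]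
    have e : profileMeanCurvature u * ((3 + 2 * cos u) * ellipseSpeed u)
        = √2 * ((3 + 2 * cos u) * (2 / (4 - 2 * cos u ^ 2)) + cos u) := by
      rw [profileMeanCurvature, ellipseSpeed_sq]
      field_simp
    have h2 : 1 / 2 ≤ 2 / (4 - 2 * cos u ^ 2) := by
      rw [div_le_div_iff₀ (by norm_num) hW]
      nlinarith [sq_nonneg (cos u)]
    rw [e]
    have h3 := mul_le_mul_of_nonneg_left h2 hr.le
    have h4 : √2 * (3 / 2) + √2 * 2 * cos u = √2 * ((3 + 2 * cos u) * (1 / 2) + cos u) := by ring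
    rw [h4]
    gcongr
  rw [integral_const_add_const_mul_cos] at h
  nlinarith [mul_le_mul_of_nonneg_left h two_pi_pos.le]

/-- This is `∫ (H - c)² dμ ≥ 0`, a linearized Cauchy–Schwarz inequality. -/
theorem totalSquareMeanCurvature_ellipticTorus_ge (c : ℝ) :
    2 * c * surfaceIntegral ellipticTorus (meanCurvature ellipticTorus)
        - c ^ 2 * surfaceIntegral ellipticTorus (fun _ _ => 1)
      ≤ surfaceIntegral ellipticTorus (fun u v => meanCurvature ellipticTorus u v ^ 2) := by
  rw [meanCurvature_ellipticTorus_eq_profile, surfaceIntegral_ellipticTorus,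
    surfaceIntegral_ellipticTorus (fun _ => 1),
    surfaceIntegral_ellipticTorus (fun u => profileMeanCurvature u ^ 2)]
  have hw := contDiff_ellipseSpeed.continuous
  have hH := contDiff_profileMeanCurvature.continuous
  have h : ∫ u in (0 : ℝ)..(2 * π),
        (2 * c * (profileMeanCurvature u * ((3 + 2 * cos u) * ellipseSpeed u))
          - c ^ 2 * (1 * ((3 + 2 * cos u) * ellipseSpeed u)))
      ≤ ∫ u in (0 : ℝ)..(2 * π),
        profileMeanCurvature u ^ 2 * ((3 + 2 * cos u) * ellipseSpeed u) := by
    refine intervalIntegral.integral_mono_on two_pi_pos.le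
      (Continuous.intervalIntegrable (by fun_prop) _ _)
      (Continuous.intervalIntegrable (by fun_prop) _ _) fun u _ => ?_
    nlinarith [mul_nonneg (sq_nonneg (profileMeanCurvature u - c))
      (mul_pos (radius_pos u) (ellipseSpeed_pos u)).le]
  rw [intervalIntegral.integral_sub (Continuous.intervalIntegrable (by fun_prop) _ _)
    (Continuous.intervalIntegrable (by fun_prop) _ _), intervalIntegral.integral_const_mul,
    intervalIntegral.integral_const_mul] at h
  nlinarith [mul_le_mul_of_nonneg_left h two_pi_pos.le]

theorem totalMeanCurvature_ellipticTorus_pos :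
    0 < surfaceIntegral ellipticTorus (meanCurvature ellipticTorus) :=
  lt_of_lt_of_le (by positivity) totalMeanCurvature_ellipticTorus_ge

theorem one_quarter_lt_averageMeanCurvature : 1 / 4 < averageMeanCurvature ellipticTorus := by
  have h1 := totalMeanCurvature_ellipticTorus_ge
  have h2 := area_ellipticTorus_le
  have h3 : (1 : ℝ) < √2 := Real.lt_sqrt_of_sq_lt (by norm_num)
  rw [averageMeanCurvature, lt_div_iff₀ area_ellipticTorus_pos]
  nlinarith [mul_pos (sub_pos.2 h3) (pow_pos pi_pos 2)]

theorem one_quarter_lt_squareMeanCurvatureRatio :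
    1 / 4 < squareMeanCurvatureRatio ellipticTorus := by
  have h1 := totalMeanCurvature_ellipticTorus_ge
  have h2 := area_ellipticTorus_le
  have h3 : (1.4 : ℝ) < √2 := Real.lt_sqrt_of_sq_lt (by norm_num)
  -- At the target value `c = 1/4`, the bound exceeds `(1/4) ∫ H` by `(1/4)(∫ H - (1/4) ∫ 1)`,
  -- positive because the average exceeds `1/4`.
  have h4 := totalSquareMeanCurvature_ellipticTorus_ge (1 / 4)
  have h5 := totalMeanCurvature_ellipticTorus_pos
  rw [squareMeanCurvatureRatio, lt_div_iff₀ h5]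
  nlinarith [mul_pos (sub_pos.2 h3) (pow_pos pi_pos 2)]

/-! ### Calculus on a space-time slab -/

/-- The space-time slab `[0, T) × ℝ²`. -/
def slab (T : ℝ) : Set (ℝ × ℝ × ℝ) := Ico 0 T ×ˢ univ

/-- The derivative in the direction `w` of a function on the slab, one-sided at `t = 0`. -/
noncomputable def slabDeriv {V : Type*} [NormedAddCommGroup V] [NormedSpace ℝ V] (T : ℝ)
    (w : ℝ × ℝ × ℝ) (Φ : ℝ × ℝ × ℝ → V) (q : ℝ × ℝ × ℝ) : V :=
  fderivWithin ℝ Φ (slab T) q w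

section Slab

variable {V : Type*} [NormedAddCommGroup V] [NormedSpace ℝ V] {T : ℝ} {Φ : ℝ × ℝ × ℝ → V}

theorem mem_slab {t : ℝ} (ht : t ∈ Ico 0 T) (p : ℝ × ℝ) : (t, p) ∈ slab T := ⟨ht, mem_univ _⟩

theorem uniqueDiffOn_slab : UniqueDiffOn ℝ (slab T) :=
  (uniqueDiffOn_Ico 0 T).prod uniqueDiffOn_univ

/-- Second derivatives within a set are symmetric at points in the closure of its interior; this
covers the boundary time `t = 0`. -/
theorem slab_subset_closure_interior : slab T ⊆ closure (interior (slab T)) := by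
  rintro ⟨t, p⟩ ⟨ht, -⟩
  have ht' : t ∈ Ico 0 T := ht
  rw [slab, interior_prod_eq, closure_prod_eq, interior_univ, closure_univ, interior_Ico,
    closure_Ioo (ht'.1.trans_lt ht'.2).ne]
  exact ⟨Ico_subset_Icc_self ht', mem_univ _⟩

theorem ContDiffOn.slabDeriv (hΦ : ContDiffOn ℝ ∞ Φ (slab T)) (w : ℝ × ℝ × ℝ) :
    ContDiffOn ℝ ∞ (slabDeriv T w Φ) (slab T) :=
  (hΦ.fderivWithin uniqueDiffOn_slab (by simp)).clm_apply contDiffOn_const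

theorem hasFDerivWithinAt_slab (hΦ : ContDiffOn ℝ ∞ Φ (slab T)) {q : ℝ × ℝ × ℝ}
    (hq : q ∈ slab T) : HasFDerivWithinAt Φ (fderivWithin ℝ Φ (slab T) q) (slab T) q :=
  (hΦ.differentiableOn (by simp) q hq).hasFDerivWithinAt

theorem hasDerivWithinAt_slabDeriv (hΦ : ContDiffOn ℝ ∞ Φ (slab T)) {t : ℝ} (ht : t ∈ Ico 0 T)
    (u v : ℝ) :
    HasDerivWithinAt (fun s => Φ (s, u, v)) (slabDeriv T (1, 0, 0) Φ (t, u, v)) (Ico 0 T) t :=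
  (hasFDerivWithinAt_slab hΦ (mem_slab ht (u, v))).comp_hasDerivWithinAt t
    ((hasDerivWithinAt_id t _).prodMk (hasDerivWithinAt_const t _ (u, v)))
    fun _ hs => mem_slab hs _

theorem deriv_slab_u (hΦ : ContDiffOn ℝ ∞ Φ (slab T)) {t : ℝ} (ht : t ∈ Ico 0 T) (u v : ℝ) :
    deriv (fun s => Φ (t, s, v)) u = slabDeriv T (0, 1, 0) Φ (t, u, v) := by
  refine HasDerivAt.deriv (hasDerivWithinAt_univ.1 ?_)
  exact (hasFDerivWithinAt_slab hΦ (mem_slab ht (u, v))).comp_hasDerivWithinAt u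
    ((hasDerivWithinAt_const u _ t).prodMk
      ((hasDerivWithinAt_id u _).prodMk (hasDerivWithinAt_const u _ v)))
    fun _ _ => mem_slab ht _

theorem deriv_slab_v (hΦ : ContDiffOn ℝ ∞ Φ (slab T)) {t : ℝ} (ht : t ∈ Ico 0 T) (u v : ℝ) :
    deriv (fun s => Φ (t, u, s)) v = slabDeriv T (0, 0, 1) Φ (t, u, v) := by
  refine HasDerivAt.deriv (hasDerivWithinAt_univ.1 ?_)
  exact (hasFDerivWithinAt_slab hΦ (mem_slab ht (u, v))).comp_hasDerivWithinAt v
    ((hasDerivWithinAt_const v _ t).prodMk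
      ((hasDerivWithinAt_const v _ u).prodMk (hasDerivWithinAt_id v _)))
    fun _ _ => mem_slab ht _

/-- Used at `t = 0` to turn time derivatives of spatial derivatives into spatial derivatives of the
velocity. -/
theorem slabDeriv_comm (hΦ : ContDiffOn ℝ ∞ Φ (slab T)) (w w' : ℝ × ℝ × ℝ) {q : ℝ × ℝ × ℝ}
    (hq : q ∈ slab T) :
    slabDeriv T w (slabDeriv T w' Φ) q = slabDeriv T w' (slabDeriv T w Φ) q := by
  have hsymm : IsSymmSndFDerivWithinAt ℝ Φ (slab T) q :=
    (hΦ q hq).isSymmSndFDerivWithinAt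
      (by rw [minSmoothness_of_isRCLikeNormedField]; exact ENat.LEInfty.out) uniqueDiffOn_slab
      (slab_subset_closure_interior hq) hq
  have hd : DifferentiableWithinAt ℝ (fderivWithin ℝ Φ (slab T)) (slab T) q :=
    (hΦ.fderivWithin uniqueDiffOn_slab (m := ∞) (by simp)).differentiableOn (by simp) q hq
  have key : ∀ w w' : ℝ × ℝ × ℝ, slabDeriv T w (slabDeriv T w' Φ) q
      = fderivWithin ℝ (fderivWithin ℝ Φ (slab T)) (slab T) q w w' := by
    intro w w'
    have h := hd.hasFDerivWithinAt.clm_apply (hasFDerivWithinAt_const w' q (slab T))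
    have h' := h.fderivWithin (uniqueDiffOn_slab q hq)
    change fderivWithin ℝ (fun y => fderivWithin ℝ Φ (slab T) y w') (slab T) q w = _
    rw [h']
    simp
  rw [key, key, hsymm.eq]

theorem tendsto_slab_zero {Y : Type*} [TopologicalSpace Y] {k : ℝ × ℝ × ℝ → Y} (hT : 0 < T)
    (hk : ContinuousOn k (slab T)) (u v : ℝ) :
    Tendsto (fun t => k (t, u, v)) (𝓝[>] 0) (𝓝 (k (0, u, v))) := by
  have hc : ContinuousWithinAt k (slab T) (0, u, v) := hk _ (mem_slab ⟨le_rfl, hT⟩ _)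
  refine hc.tendsto.comp (tendsto_nhdsWithin_iff.2 ⟨?_, ?_⟩)
  · exact ((show Continuous fun t : ℝ => (t, u, v) by fun_prop).tendsto 0).mono_left
      nhdsWithin_le_nhds
  · filter_upwards [Ioo_mem_nhdsGT hT] with t ht
    exact mem_slab (Ioo_subset_Ico_self ht) _

theorem tendsto_integral_slab_zero {k : ℝ × ℝ × ℝ → ℝ} (hT : 0 < T)
    (hk : ContinuousOn k (slab T)) (a b c d : ℝ) :
    Tendsto (fun t => ∫ u in a..b, ∫ v in c..d, k (t, u, v)) (𝓝[>] 0)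
      (𝓝 (∫ u in a..b, ∫ v in c..d, k (0, u, v))) := by
  -- Clamping time to `[0, T/2]` extends `k` continuously to all of space-time without changing it
  -- for small `t ≥ 0`, so continuity of parametric integrals applies.
  have hclamp : ∀ t : ℝ, max 0 (min t (T / 2)) ∈ Ico 0 T := fun t =>
    ⟨le_max_left _ _, max_lt hT ((min_le_right _ _).trans_lt (by linarith))⟩
  have hk' : Continuous fun q : ℝ × ℝ × ℝ => k (max 0 (min q.1 (T / 2)), q.2) :=
    hk.comp_continuous (by fun_prop) fun q => mem_slab (hclamp q.1) _
  have hint : Continuous fun t : ℝ =>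
      ∫ u in a..b, ∫ v in c..d, k (max 0 (min t (T / 2)), u, v) := by
    refine intervalIntegral.continuous_parametric_intervalIntegral_of_continuous' ?_ _ _
    refine intervalIntegral.continuous_parametric_intervalIntegral_of_continuous'
      (f := fun (p : ℝ × ℝ) v => k (max 0 (min p.1 (T / 2)), p.2, v)) ?_ _ _
    exact hk'.comp (show Continuous fun p : (ℝ × ℝ) × ℝ => (p.1.1, p.1.2, p.2) by fun_prop)
  have h0 := (hint.tendsto 0).mono_left (nhdsWithin_le_nhds (s := Ioi 0))
  rw [min_eq_left (by linarith : (0 : ℝ) ≤ T / 2), max_self] at h0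
  refine h0.congr' ?_
  filter_upwards [Ioo_mem_nhdsGT (show 0 < T / 2 by linarith)] with t ht
  rw [min_eq_left ht.2.le, max_eq_right ht.1.le]

end Slab

/-- A function on the slab which vanishes at time zero and has negative time derivative there is
negative for small positive times, uniformly in the last variable if it is periodic in it. -/
theorem eventually_neg_of_slabDeriv_neg {T : ℝ} (hT : 0 < T) {Q : ℝ × ℝ × ℝ → ℝ}
    (hQ : ContDiffOn ℝ ∞ Q (slab T)) {c u : ℝ} (hc : 0 < c)
    (hper : ∀ t ∈ Ico 0 T, ∀ v, Q (t, u, v + c) = Q (t, u, v))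
    (h0 : ∀ v, Q (0, u, v) = 0) (hneg : ∀ v, slabDeriv T (1, 0, 0) Q (0, u, v) < 0) :
    ∃ ε, 0 < ε ∧ ε ≤ T ∧ ∀ t ∈ Ioo 0 ε, ∀ v, Q (t, u, v) < 0 := by
  have hev : ∀ᶠ t in 𝓝[Ico 0 T] (0 : ℝ), ∀ v ∈ Icc 0 c, slabDeriv T (1, 0, 0) Q (t, u, v) < 0 := by
    have hclamp : ∀ t : ℝ, max 0 (min t (T / 2)) ∈ Ico 0 T := fun t =>
      ⟨le_max_left _ _, max_lt hT ((min_le_right _ _).trans_lt (by linarith))⟩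
    have hk' : Continuous fun p : ℝ × ℝ =>
        slabDeriv T (1, 0, 0) Q (max 0 (min p.1 (T / 2)), u, p.2) :=
      (hQ.slabDeriv (1, 0, 0)).continuousOn.comp_continuous (by fun_prop)
        fun p => mem_slab (hclamp p.1) _
    have h1 : ∀ᶠ t in 𝓝 (0 : ℝ), ∀ v ∈ Icc 0 c,
        slabDeriv T (1, 0, 0) Q (max 0 (min t (T / 2)), u, v) < 0 := by
      -- Tube lemma: negativity at time zero over a full period persists for a time independent of
      -- `v`.
      refine isCompact_Icc.eventually_forall_of_forall_eventually fun v _ => ?_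
      refine hk'.continuousAt.eventually (gt_mem_nhds ?_)
      dsimp only
      rw [min_eq_left (by linarith : (0 : ℝ) ≤ T / 2), max_self]
      exact hneg v
    filter_upwards [nhdsWithin_le_nhds h1, self_mem_nhdsWithin,
      nhdsWithin_le_nhds (gt_mem_nhds (show (0 : ℝ) < T / 2 by linarith))] with t ht ht1 ht2
    rwa [min_eq_left ht2.le, max_eq_right ht1.1] at ht
  obtain ⟨δ, hδ, hball⟩ := Metric.mem_nhdsWithin_iff.1 hev
  refine ⟨min δ T, lt_min hδ hT, min_le_right _ _, fun t ht v => ?_⟩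
  have htT : t ∈ Ioo 0 T := ⟨ht.1, ht.2.trans_le (min_le_right _ _)⟩
  obtain ⟨v', hv', hv⟩ := Function.Periodic.exists_mem_Ico₀ (f := fun v => Q (t, u, v))
    (fun v => hper t (Ioo_subset_Ico_self htT) v) hc v
  rw [hv, ← h0 v']
  have hsub : Icc 0 t ⊆ Ico 0 T := fun s hs => ⟨hs.1, hs.2.trans_lt htT.2⟩
  -- Strict decrease from the initial value `Q (0, u, v') = 0` gives the claim.
  have hanti : StrictAntiOn (fun s => Q (s, u, v')) (Icc 0 t) := by
    refine strictAntiOn_of_deriv_neg (convex_Icc 0 t) (fun s hs => ?_) fun s hs => ?_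
    · exact ((hasDerivWithinAt_slabDeriv hQ (hsub hs) u v').continuousWithinAt).mono hsub
    · rw [interior_Icc] at hs
      have hsT := hsub (Ioo_subset_Icc_self hs)
      rw [((hasDerivWithinAt_slabDeriv hQ hsT u v').hasDerivAt
        (Ico_mem_nhds hs.1 hsT.2)).deriv]
      refine hball ⟨?_, hsT⟩ v' (Ico_subset_Icc_self hv')
      rw [Metric.mem_ball, Real.dist_eq, sub_zero, abs_of_pos hs.1]
      exact hs.2.trans (ht.2.trans_le (min_le_left _ _))
  exact hanti (left_mem_Icc.2 ht.1.le) (right_mem_Icc.2 ht.1.le) ht.1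

/-! ### The initial velocity of the flow -/

/-- The factor `sin u` is kept explicit here and in the next derivatives: first derivatives then
vanish at `π`, and a second derivative of the form `(sin · S)'` is just `-S π`. -/
theorem hasDerivAt_ellipseSpeed (u : ℝ) :
    HasDerivAt ellipseSpeed (sin u * (2 * cos u / ellipseSpeed u)) u := by
  have h : HasDerivAt (fun u : ℝ => 4 - 2 * cos u ^ 2) (4 * cos u * sin u) u :=
    ((((hasDerivAt_cos u).pow 2).const_mul 2).const_sub 4).congr_deriv (by push_cast; ring)
  have hpos : 4 - 2 * cos u ^ 2 ≠ 0 := by nlinarith [cos_sq_le_one u]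
  refine (h.sqrt hpos).congr_deriv ?_
  change _ / (2 * ellipseSpeed u) = _
  have := (ellipseSpeed_pos u).ne'
  field_simp
  ring

theorem ellipseSpeed_pi : ellipseSpeed π = √2 := by
  rw [ellipseSpeed, cos_pi]
  norm_num

theorem profileMeanCurvature_pi : profileMeanCurvature π = 0 := by
  rw [profileMeanCurvature, ellipseSpeed_sq, cos_pi]
  norm_num

theorem hasDerivAt_profileMeanCurvature (u : ℝ) :
    HasDerivAt profileMeanCurvature
      (sin u * (-(2 * √2 * cos u / ellipseSpeed u ^ 3)
          * (2 / ellipseSpeed u ^ 2 + cos u / (3 + 2 * cos u))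
        - √2 / ellipseSpeed u * (8 * cos u / ellipseSpeed u ^ 4 + 3 / (3 + 2 * cos u) ^ 2))) u := by
  have hw := (ellipseSpeed_pos u).ne'
  have hr := (radius_pos u).ne'
  have hW := hasDerivAt_ellipseSpeed u
  have hR : HasDerivAt (fun u : ℝ => 3 + 2 * cos u) (2 * -sin u) u :=
    ((hasDerivAt_cos u).const_mul 2).const_add 3
  refine (((hasDerivAt_const u (√2)).div hW hw).mul
    (((hasDerivAt_const u (2 : ℝ)).div (hW.pow 2) (pow_ne_zero 2 hw)).add
      ((hasDerivAt_cos u).div hR hr))).congr_deriv ?_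
  simp only [Pi.div_apply, Pi.pow_apply, Pi.add_apply]
  field_simp
  ring

/-- The radial component of the unit normal of the elliptic torus. -/
noncomputable def normalRadius (u : ℝ) : ℝ := √2 * cos u / ellipseSpeed u

theorem hasDerivAt_normalRadius (u : ℝ) :
    HasDerivAt normalRadius
      (sin u * (-(√2 / ellipseSpeed u) - 2 * √2 * cos u ^ 2 / ellipseSpeed u ^ 3)) u := by
  have hw := (ellipseSpeed_pos u).ne'
  refine (((hasDerivAt_cos u).const_mul (√2)).div (hasDerivAt_ellipseSpeed u) hw).congr_deriv ?_
  field_simp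

/-- The radial component of the initial velocity, with global term `h`. -/
noncomputable def velocityRadius (h u : ℝ) : ℝ := (h - profileMeanCurvature u) * normalRadius u

/-- The vertical component of the initial velocity, with global term `h`. -/
noncomputable def velocityHeight (h u : ℝ) : ℝ :=
  (h - profileMeanCurvature u) * (2 * sin u / ellipseSpeed u)

theorem contDiff_velocityRadius (h : ℝ) : ContDiff ℝ ∞ (velocityRadius h) :=
  (contDiff_const.sub contDiff_profileMeanCurvature).mul
    (ContDiff.div (by fun_prop) contDiff_ellipseSpeed fun u => (ellipseSpeed_pos u).ne')

theorem contDiff_velocityHeight (h : ℝ) : ContDiff ℝ ∞ (velocityHeight h) :=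
  (contDiff_const.sub contDiff_profileMeanCurvature).mul
    (ContDiff.div (by fun_prop) contDiff_ellipseSpeed fun u => (ellipseSpeed_pos u).ne')

/-- The initial velocity has the form of a surface of revolution, so the derivative formulas for
`revolve` apply to it. -/
theorem smul_unitNormal_ellipticTorus (h u v : ℝ) :
    (h - meanCurvature ellipticTorus u v) • unitNormal ellipticTorus u v
      = revolve (velocityRadius h) (velocityHeight h) u v := by
  rw [unitNormal_ellipticTorus, meanCurvature_ellipticTorus_eq_profile]
  ext i
  fin_cases i <;> simp [velocityRadius, velocityHeight, normalRadius] <;> ring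

theorem velocityRadius_pi (h : ℝ) : velocityRadius h π = -h := by
  rw [velocityRadius, profileMeanCurvature_pi, normalRadius, ellipseSpeed_pi, cos_pi]
  field_simp
  ring

/-- The quotient of the derivative of `velocityRadius` by `sin`. -/
noncomputable def velocityRadiusSlope (h u : ℝ) : ℝ :=
  -((-(2 * √2 * cos u / ellipseSpeed u ^ 3)
          * (2 / ellipseSpeed u ^ 2 + cos u / (3 + 2 * cos u))
        - √2 / ellipseSpeed u * (8 * cos u / ellipseSpeed u ^ 4 + 3 / (3 + 2 * cos u) ^ 2))
      * normalRadius u)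
    + (h - profileMeanCurvature u)
      * (-(√2 / ellipseSpeed u) - 2 * √2 * cos u ^ 2 / ellipseSpeed u ^ 3)

theorem deriv_velocityRadius (h : ℝ) :
    deriv (velocityRadius h) = fun u => sin u * velocityRadiusSlope h u := by
  funext u
  exact (((hasDerivAt_profileMeanCurvature u).const_sub h).mul
    (hasDerivAt_normalRadius u)).deriv.trans (by rw [velocityRadiusSlope]; ring)

theorem deriv_velocityRadius_pi (h : ℝ) : deriv (velocityRadius h) π = 0 := by
  rw [deriv_velocityRadius]
  simp

theorem differentiableAt_velocityRadiusSlope (h u : ℝ) :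
    DifferentiableAt ℝ (velocityRadiusSlope h) u := by
  have hw := (ellipseSpeed_pos u).ne'
  have hr := (radius_pos u).ne'
  have h1 := (hasDerivAt_ellipseSpeed u).differentiableAt
  have h2 := (hasDerivAt_profileMeanCurvature u).differentiableAt
  have h3 := (hasDerivAt_normalRadius u).differentiableAt
  unfold velocityRadiusSlope
  fun_prop (disch := first | exact hw | exact hr | exact pow_ne_zero _ hw | exact pow_ne_zero _ hr)

theorem velocityRadiusSlope_pi (h : ℝ) : velocityRadiusSlope h π = -(1 + 2 * h) := by
  have h3 : √(2 : ℝ) ^ 3 = 2 * √2 := by rw [pow_succ, sqrt_two_sq]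
  have h4 : √(2 : ℝ) ^ 4 = 4 := by rw [show 4 = 2 * 2 from rfl, pow_mul, sqrt_two_sq]; norm_num
  have h0 : √(2 : ℝ) ≠ 0 := by positivity
  rw [velocityRadiusSlope, profileMeanCurvature_pi, normalRadius, ellipseSpeed_pi, cos_pi, h3, h4,
    sqrt_two_sq]
  field_simp
  ring

theorem deriv_deriv_velocityRadius_pi (h : ℝ) :
    deriv (deriv (velocityRadius h)) π = 1 + 2 * h := by
  rw [deriv_velocityRadius]
  refine ((hasDerivAt_sin π).mul
    (differentiableAt_velocityRadiusSlope h π).hasDerivAt).deriv.trans ?_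
  rw [sin_pi, cos_pi, velocityRadiusSlope_pi]
  ring

theorem deriv_velocityHeight_pi (h : ℝ) : deriv (velocityHeight h) π = -(√2 * h) := by
  refine (((hasDerivAt_profileMeanCurvature π).const_sub h).mul
    (((hasDerivAt_sin π).const_mul 2).div (hasDerivAt_ellipseSpeed π)
      (ellipseSpeed_pos π).ne')).deriv.trans ?_
  rw [profileMeanCurvature_pi, ellipseSpeed_pi, cos_pi, sin_pi, sqrt_two_sq]
  ring

/-! ### The variation of the curvature numerator -/

theorem hasDerivWithinAt_curvatureNumerator {a b p q r m : ℝ → E3} {a' b' p' q' r' m' : E3}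
    {s : Set ℝ} {x : ℝ} (ha : HasDerivWithinAt a a' s x) (hb : HasDerivWithinAt b b' s x)
    (hp : HasDerivWithinAt p p' s x) (hq : HasDerivWithinAt q q' s x)
    (hm : HasDerivWithinAt m m' s x) (hr : HasDerivWithinAt r r' s x) :
    HasDerivWithinAt (fun y => curvatureNumerator (a y) (b y) (p y) (q y) (m y) (r y))
      ((inner ℝ (a x) b' + inner ℝ a' (b x))
          * (inner ℝ (cross (b x) (a x)) (q x) + inner ℝ (cross (b x) (a x)) (m x))
        + inner ℝ (a x) (b x)
          * ((inner ℝ (cross (b x) (a x)) q' + inner ℝ (cross b' (a x) + cross (b x) a') (q x))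
            + (inner ℝ (cross (b x) (a x)) m' + inner ℝ (cross b' (a x) + cross (b x) a') (m x)))
        - ((inner ℝ (b x) b' + inner ℝ b' (b x)) * inner ℝ (cross (b x) (a x)) (p x)
          + inner ℝ (b x) (b x) * (inner ℝ (cross (b x) (a x)) p'
            + inner ℝ (cross b' (a x) + cross (b x) a') (p x)))
        - ((inner ℝ (a x) a' + inner ℝ a' (a x)) * inner ℝ (cross (b x) (a x)) (r x)
          + inner ℝ (a x) (a x) * (inner ℝ (cross (b x) (a x)) r'
            + inner ℝ (cross b' (a x) + cross (b x) a') (r x)))) s x := by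
  have hn := hb.cross ha
  exact (((ha.inner ℝ hb).mul ((hn.inner ℝ hq).add (hn.inner ℝ hm))).sub
    ((hb.inner ℝ hb).mul (hn.inner ℝ hp))).sub ((ha.inner ℝ ha).mul (hn.inner ℝ hr))

/-- Along a family starting at the elliptic torus whose derivatives have the variations prescribed
by the velocity of the flow, the curvature numerator has the variation `√2 (1 - 4 h)` on the inner
equator. -/
theorem hasDerivWithinAt_curvatureNumerator_ellipticTorus {h v : ℝ} {G : ℝ → ℝ → E3}
    (hG : G = revolve (velocityRadius h) (velocityHeight h))
    {a b p q r m : ℝ → E3} {s : Set ℝ}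
    (ha : HasDerivWithinAt a (du G π v) s 0) (hb : HasDerivWithinAt b (dv G π v) s 0)
    (hp : HasDerivWithinAt p (du (du G) π v) s 0) (hq : HasDerivWithinAt q (du (dv G) π v) s 0)
    (hm : HasDerivWithinAt m (dv (du G) π v) s 0) (hr : HasDerivWithinAt r (dv (dv G) π v) s 0)
    (ha0 : a 0 = du ellipticTorus π v) (hb0 : b 0 = dv ellipticTorus π v)
    (hp0 : p 0 = du (du ellipticTorus) π v) (hq0 : q 0 = du (dv ellipticTorus) π v)
    (hm0 : m 0 = dv (du ellipticTorus) π v) (hr0 : r 0 = dv (dv ellipticTorus) π v) :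
    HasDerivWithinAt (fun y => curvatureNumerator (a y) (b y) (p y) (q y) (m y) (r y))
      (√2 * (1 - 4 * h)) s 0 := by
  have hA := contDiff_velocityRadius h
  have hB := contDiff_velocityHeight h
  have hA' : ContDiff ℝ ∞ (deriv (velocityRadius h)) := ((contDiff_infty_iff_deriv).1 hA).2
  have hB' : ContDiff ℝ ∞ (deriv (velocityHeight h)) := ((contDiff_infty_iff_deriv).1 hB).2
  have e1 : du G = revolve (deriv (velocityRadius h)) (deriv (velocityHeight h)) := by
    rw [hG, du_revolve (hA.differentiable (by simp)) (hB.differentiable (by simp))]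
  have e2 : dv G = rotationField (velocityRadius h) := by rw [hG, dv_revolve]
  refine (hasDerivWithinAt_curvatureNumerator ha hb hp hq hm hr).congr_deriv ?_
  rw [ha0, hb0, hp0, hq0, hm0, hr0, e1, e2, dv_revolve, dv_rotationField,
    du_revolve (hA'.differentiable (by simp)) (hB'.differentiable (by simp)),
    du_rotationField (hA.differentiable (by simp)), du_du_ellipticTorus, du_dv_ellipticTorus,
    dv_du_ellipticTorus, dv_dv_ellipticTorus, du_ellipticTorus, dv_ellipticTorus]
  simp only [cross_rotationField_revolve, inner_add_left, inner_revolve_revolve,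
    inner_revolve_rotationField, inner_rotationField_rotationField,
    velocityRadius_pi, deriv_velocityRadius_pi, deriv_deriv_velocityRadius_pi,
    deriv_velocityHeight_pi, sin_pi, cos_pi]
  -- At `u = π` the unnormalized normal is radial, so the second derivative of the velocity's height
  -- is multiplied by zero. The result is `|∂ᵥX × ∂ᵤX|³ = 2√2` times `ΔH - h|A|² = 1/2 - 2h`.
  linear_combination -(h * √2) * sqrt_two_sq

/-! ### Smooth families of immersions -/

/-- A family of parametrizations as a function on space-time. -/
def spacetime (F : ℝ → ℝ → ℝ → E3) (q : ℝ × ℝ × ℝ) : E3 := F q.1 q.2.1 q.2.2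

/-- The unnormalized normal field of a family of parametrizations on space-time. -/
noncomputable def spacetimeNormal (T : ℝ) (F : ℝ → ℝ → ℝ → E3) (q : ℝ × ℝ × ℝ) : E3 :=
  cross (slabDeriv T (0, 0, 1) (spacetime F) q) (slabDeriv T (0, 1, 0) (spacetime F) q)

/-- The curvature numerator of a family of parametrizations on space-time. -/
noncomputable def spacetimeNumerator (T : ℝ) (F : ℝ → ℝ → ℝ → E3) (q : ℝ × ℝ × ℝ) : ℝ :=
  curvatureNumerator (slabDeriv T (0, 1, 0) (spacetime F) q) (slabDeriv T (0, 0, 1) (spacetime F) q)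
    (slabDeriv T (0, 1, 0) (slabDeriv T (0, 1, 0) (spacetime F)) q)
    (slabDeriv T (0, 1, 0) (slabDeriv T (0, 0, 1) (spacetime F)) q)
    (slabDeriv T (0, 0, 1) (slabDeriv T (0, 1, 0) (spacetime F)) q)
    (slabDeriv T (0, 0, 1) (slabDeriv T (0, 0, 1) (spacetime F)) q)

section Family

variable {T : ℝ} {F : ℝ → ℝ → ℝ → E3}

theorem slabDeriv_u_eq_du {Φ : ℝ × ℝ × ℝ → E3} {X : ℝ → ℝ → E3} {t : ℝ}
    (hΦ : ContDiffOn ℝ ∞ Φ (slab T)) (ht : t ∈ Ico 0 T) (hX : ∀ u v, Φ (t, u, v) = X u v)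
    (u v : ℝ) : slabDeriv T (0, 1, 0) Φ (t, u, v) = du X u v := by
  simp only [← deriv_slab_u hΦ ht, hX, du]

theorem slabDeriv_v_eq_dv {Φ : ℝ × ℝ × ℝ → E3} {X : ℝ → ℝ → E3} {t : ℝ}
    (hΦ : ContDiffOn ℝ ∞ Φ (slab T)) (ht : t ∈ Ico 0 T) (hX : ∀ u v, Φ (t, u, v) = X u v)
    (u v : ℝ) : slabDeriv T (0, 0, 1) Φ (t, u, v) = dv X u v := by
  simp only [← deriv_slab_v hΦ ht, hX, dv]

theorem spacetimeNumerator_eq (hF : ContDiffOn ℝ ∞ (spacetime F) (slab T)) {t : ℝ}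
    (ht : t ∈ Ico 0 T) (u v : ℝ) :
    spacetimeNumerator T F (t, u, v) = meanCurvatureNumerator (F t) u v := by
  have hu := slabDeriv_u_eq_du hF ht (X := F t) fun _ _ => rfl
  have hv := slabDeriv_v_eq_dv hF ht (X := F t) fun _ _ => rfl
  rw [spacetimeNumerator, hu, hv, slabDeriv_u_eq_du (hF.slabDeriv _) ht hu,
    slabDeriv_u_eq_du (hF.slabDeriv _) ht hv, slabDeriv_v_eq_dv (hF.slabDeriv _) ht hu,
    slabDeriv_v_eq_dv (hF.slabDeriv _) ht hv, meanCurvatureNumerator]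

theorem spacetimeNormal_eq (hF : ContDiffOn ℝ ∞ (spacetime F) (slab T)) {t : ℝ}
    (ht : t ∈ Ico 0 T) (u v : ℝ) :
    spacetimeNormal T F (t, u, v) = cross (dv (F t) u v) (du (F t) u v) := by
  rw [spacetimeNormal, slabDeriv_u_eq_du hF ht (X := F t) fun _ _ => rfl,
    slabDeriv_v_eq_dv hF ht (X := F t) fun _ _ => rfl]

theorem contDiffOn_spacetimeNormal (hF : ContDiffOn ℝ ∞ (spacetime F) (slab T)) :
    ContDiffOn ℝ ∞ (spacetimeNormal T F) (slab T) :=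
  (hF.slabDeriv _).cross (hF.slabDeriv _)

theorem contDiffOn_spacetimeNumerator (hF : ContDiffOn ℝ ∞ (spacetime F) (slab T)) :
    ContDiffOn ℝ ∞ (spacetimeNumerator T F) (slab T) := by
  have hn := contDiffOn_spacetimeNormal hF
  have hu := hF.slabDeriv (0, 1, 0)
  have hv := hF.slabDeriv (0, 0, 1)
  exact (((hu.inner ℝ hv).mul ((hn.inner ℝ (hv.slabDeriv _)).add (hn.inner ℝ (hu.slabDeriv _)))).sub
    ((hv.inner ℝ hv).mul (hn.inner ℝ (hu.slabDeriv _)))).sub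
    ((hu.inner ℝ hu).mul (hn.inner ℝ (hv.slabDeriv _)))

theorem spacetimeNormal_ne_zero (hF : ContDiffOn ℝ ∞ (spacetime F) (slab T))
    (hi : ∀ t ∈ Ico 0 T, IsTorusImmersion (F t)) {q : ℝ × ℝ × ℝ} (hq : q ∈ slab T) :
    spacetimeNormal T F q ≠ 0 := by
  obtain ⟨t, u, v⟩ := q
  rw [spacetimeNormal_eq hF hq.1]
  exact (hi t hq.1).cross_ne_zero u v

theorem continuousOn_unitNormal (hF : ContDiffOn ℝ ∞ (spacetime F) (slab T))
    (hi : ∀ t ∈ Ico 0 T, IsTorusImmersion (F t)) :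
    ContinuousOn (fun q : ℝ × ℝ × ℝ => unitNormal (F q.1) q.2.1 q.2.2) (slab T) := by
  have hn := (contDiffOn_spacetimeNormal hF).continuousOn
  refine ((hn.norm.inv₀ fun q hq => norm_ne_zero_iff.2 (spacetimeNormal_ne_zero hF hi hq)).smul
    hn).congr ?_
  rintro ⟨t, u, v⟩ hq
  change unitNormal (F t) u v = ‖spacetimeNormal T F (t, u, v)‖⁻¹ • spacetimeNormal T F (t, u, v)
  rw [unitNormal, spacetimeNormal_eq hF hq.1]

theorem continuousOn_meanCurvature (hF : ContDiffOn ℝ ∞ (spacetime F) (slab T))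
    (hi : ∀ t ∈ Ico 0 T, IsTorusImmersion (F t)) :
    ContinuousOn (fun q : ℝ × ℝ × ℝ => meanCurvature (F q.1) q.2.1 q.2.2) (slab T) := by
  have hn := (contDiffOn_spacetimeNormal hF).continuousOn
  refine ((contDiffOn_spacetimeNumerator hF).continuousOn.div (hn.norm.pow 3) fun q hq =>
    pow_ne_zero 3 (norm_ne_zero_iff.2 (spacetimeNormal_ne_zero hF hi hq))).congr ?_
  rintro ⟨t, u, v⟩ hq
  change meanCurvature (F t) u v = spacetimeNumerator T F (t, u, v) / ‖spacetimeNormal T F (t, u, v)‖ ^ 3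
  rw [(hi t hq.1).meanCurvature_eq, spacetimeNormal_eq hF hq.1, spacetimeNumerator_eq hF hq.1]

theorem continuousOn_sqrt_det (hF : ContDiffOn ℝ ∞ (spacetime F) (slab T)) :
    ContinuousOn (fun q : ℝ × ℝ × ℝ => √(firstFundamentalForm (F q.1) q.2.1 q.2.2).det)
      (slab T) := by
  refine (contDiffOn_spacetimeNormal hF).continuousOn.norm.congr ?_
  rintro ⟨t, u, v⟩ hq
  dsimp only
  rw [spacetimeNormal_eq hF hq.1, sqrt_det_firstFundamentalForm]

theorem tendsto_surfaceIntegral (hT : 0 < T) (hF : ContDiffOn ℝ ∞ (spacetime F) (slab T))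
    {f : ℝ → ℝ → ℝ → ℝ} (hf : ContinuousOn (fun q : ℝ × ℝ × ℝ => f q.1 q.2.1 q.2.2) (slab T)) :
    Tendsto (fun t => surfaceIntegral (F t) (f t)) (𝓝[>] 0) (𝓝 (surfaceIntegral (F 0) (f 0))) :=
  tendsto_integral_slab_zero hT (hf.mul (continuousOn_sqrt_det hF)) _ _ _ _

theorem tendsto_averageMeanCurvature (hT : 0 < T) (hF : ContDiffOn ℝ ∞ (spacetime F) (slab T))
    (hi : ∀ t ∈ Ico 0 T, IsTorusImmersion (F t)) (h0 : surfaceIntegral (F 0) (fun _ _ => 1) ≠ 0) :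
    Tendsto (fun t => averageMeanCurvature (F t)) (𝓝[>] 0) (𝓝 (averageMeanCurvature (F 0))) :=
  (tendsto_surfaceIntegral hT hF (f := fun t => meanCurvature (F t))
    (continuousOn_meanCurvature hF hi)).div
    (tendsto_surfaceIntegral hT hF (f := fun _ _ _ => 1) continuousOn_const) h0

theorem tendsto_squareMeanCurvatureRatio (hT : 0 < T)
    (hF : ContDiffOn ℝ ∞ (spacetime F) (slab T)) (hi : ∀ t ∈ Ico 0 T, IsTorusImmersion (F t))
    (h0 : surfaceIntegral (F 0) (meanCurvature (F 0)) ≠ 0) :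
    Tendsto (fun t => squareMeanCurvatureRatio (F t)) (𝓝[>] 0)
      (𝓝 (squareMeanCurvatureRatio (F 0))) :=
  (tendsto_surfaceIntegral hT hF (f := fun t u v => meanCurvature (F t) u v ^ 2)
    ((continuousOn_meanCurvature hF hi).pow 2)).div
    (tendsto_surfaceIntegral hT hF (f := fun t => meanCurvature (F t))
      (continuousOn_meanCurvature hF hi)) h0

end Family

/-! ### The flow starting at the elliptic torus -/

section Flow

variable {T : ℝ} {F : ℝ → ℝ → ℝ → E3} {h : (ℝ → ℝ → E3) → ℝ}

theorem IsConstrainedMCF.initial_eq {X₀ : ℝ → ℝ → E3} (hF : IsConstrainedMCF h X₀ T F) :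
    F 0 = X₀ := by
  funext u v
  exact hF.initial u v

/-- The evolution equation persists up to the initial time. -/
theorem IsConstrainedMCF.slabDeriv_zero {X₀ : ℝ → ℝ → E3} (hF : IsConstrainedMCF h X₀ T F)
    (hT : 0 < T) (hh : Tendsto (fun t => h (F t)) (𝓝[>] 0) (𝓝 (h X₀))) (u v : ℝ) :
    slabDeriv T (1, 0, 0) (spacetime F) (0, u, v)
      = (h X₀ - meanCurvature X₀ u v) • unitNormal X₀ u v := by
  have hs : ContDiffOn ℝ ∞ (spacetime F) (slab T) := hF.smooth
  have h1 := tendsto_slab_zero hT (hs.slabDeriv (1, 0, 0)).continuousOn u v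
  have h2 := (hh.sub (tendsto_slab_zero hT (continuousOn_meanCurvature hs hF.immersion) u v)).smul
    (tendsto_slab_zero hT (continuousOn_unitNormal hs hF.immersion) u v)
  simp only [hF.initial_eq] at h2
  -- For `t > 0` the two expressions agree by the evolution equation, so their limits at `0` agree.
  refine tendsto_nhds_unique h1 (h2.congr' ?_)
  filter_upwards [Ioo_mem_nhdsGT hT] with t ht
  have h3 := (hasDerivWithinAt_slabDeriv hs (Ioo_subset_Ico_self ht) u v).hasDerivAt
    (Ico_mem_nhds ht.1 ht.2)
  exact (hF.evolution t ht u v).unique h3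

/-- By commuting derivatives, each spatial derivative of `F` varies at `t = 0` by the same
derivative of the velocity field `G`; second derivatives need two commutations. -/
theorem IsConstrainedMCF.slabDeriv_spacetimeNumerator (hF : IsConstrainedMCF h ellipticTorus T F)
    (hT : 0 < T) (hh : Tendsto (fun t => h (F t)) (𝓝[>] 0) (𝓝 (h ellipticTorus))) (v : ℝ) :
    slabDeriv T (1, 0, 0) (spacetimeNumerator T F) (0, π, v)
      = √2 * (1 - 4 * h ellipticTorus) := by
  have hs : ContDiffOn ℝ ∞ (spacetime F) (slab T) := hF.smooth
  have h0 : (0 : ℝ) ∈ Ico 0 T := ⟨le_rfl, hT⟩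
  have hu := slabDeriv_u_eq_du hs h0 hF.initial
  have hv := slabDeriv_v_eq_dv hs h0 hF.initial
  set G : ℝ → ℝ → E3 := revolve (velocityRadius (h ellipticTorus)) (velocityHeight (h ellipticTorus))
    with hG
  have ht : ∀ u v, slabDeriv T (1, 0, 0) (spacetime F) (0, u, v) = G u v := fun u v => by
    rw [hF.slabDeriv_zero hT hh, smul_unitNormal_ellipticTorus]
  have htu : ∀ u v, slabDeriv T (1, 0, 0) (slabDeriv T (0, 1, 0) (spacetime F)) (0, u, v)
      = du G u v := fun u v => by
    rw [slabDeriv_comm hs _ _ (mem_slab h0 _), slabDeriv_u_eq_du (hs.slabDeriv _) h0 ht]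
  have htv : ∀ u v, slabDeriv T (1, 0, 0) (slabDeriv T (0, 0, 1) (spacetime F)) (0, u, v)
      = dv G u v := fun u v => by
    rw [slabDeriv_comm hs _ _ (mem_slab h0 _), slabDeriv_v_eq_dv (hs.slabDeriv _) h0 ht]
  have hsu := hs.slabDeriv (0, 1, 0)
  have hsv := hs.slabDeriv (0, 0, 1)
  have key := hasDerivWithinAt_curvatureNumerator_ellipticTorus (v := v) hG
    ((hasDerivWithinAt_slabDeriv hsu h0 π v).congr_deriv (htu π v))
    ((hasDerivWithinAt_slabDeriv hsv h0 π v).congr_deriv (htv π v))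
    ((hasDerivWithinAt_slabDeriv (hsu.slabDeriv (0, 1, 0)) h0 π v).congr_deriv
      ((slabDeriv_comm hsu _ _ (mem_slab h0 _)).trans
        (slabDeriv_u_eq_du (hsu.slabDeriv _) h0 htu π v)))
    ((hasDerivWithinAt_slabDeriv (hsv.slabDeriv (0, 1, 0)) h0 π v).congr_deriv
      ((slabDeriv_comm hsv _ _ (mem_slab h0 _)).trans
        (slabDeriv_u_eq_du (hsv.slabDeriv _) h0 htv π v)))
    ((hasDerivWithinAt_slabDeriv (hsu.slabDeriv (0, 0, 1)) h0 π v).congr_deriv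
      ((slabDeriv_comm hsu _ _ (mem_slab h0 _)).trans
        (slabDeriv_v_eq_dv (hsu.slabDeriv _) h0 htu π v)))
    ((hasDerivWithinAt_slabDeriv (hsv.slabDeriv (0, 0, 1)) h0 π v).congr_deriv
      ((slabDeriv_comm hsv _ _ (mem_slab h0 _)).trans
        (slabDeriv_v_eq_dv (hsv.slabDeriv _) h0 htv π v)))
    (hu π v) (hv π v) (slabDeriv_u_eq_du hsu h0 hu π v) (slabDeriv_u_eq_du hsv h0 hv π v)
    (slabDeriv_v_eq_dv hsu h0 hu π v) (slabDeriv_v_eq_dv hsv h0 hv π v)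
  -- One-sided derivatives at the endpoint `0` of `[0, T)` are unique.
  exact (uniqueDiffOn_Ico 0 T 0 h0).eq_deriv _
    (hasDerivWithinAt_slabDeriv (contDiffOn_spacetimeNumerator hs) h0 π v) key

/-- Only two facts about the global term enter, convergence to its initial value and that value
exceeding `1/4`, so both flows are treated at once. -/
theorem IsConstrainedMCF.exists_meanCurvature_neg (hF : IsConstrainedMCF h ellipticTorus T F)
    (hT : 0 < T) (hh : Tendsto (fun t => h (F t)) (𝓝[>] 0) (𝓝 (h ellipticTorus)))
    (h4 : 1 / 4 < h ellipticTorus) :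
    ∃ ε : ℝ, 0 < ε ∧ ε ≤ T ∧ ∀ t ∈ Ioo 0 ε,
      (∀ v, meanCurvature (F t) π v < 0) ∧
      (⨅ p : ℝ × ℝ, meanCurvature (F t) p.1 p.2) < 0 := by
  have hs : ContDiffOn ℝ ∞ (spacetime F) (slab T) := hF.smooth
  have h0 : (0 : ℝ) ∈ Ico 0 T := ⟨le_rfl, hT⟩
  obtain ⟨ε, hε, hεT, hneg⟩ := eventually_neg_of_slabDeriv_neg hT
    (contDiffOn_spacetimeNumerator hs) (u := π) two_pi_pos
    (fun t ht v => by
      have hp := (hF.immersion t ht).periodic_v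
      have h1 := du_add_right hp
      have h2 := dv_add_right hp
      rw [spacetimeNumerator_eq hs ht, spacetimeNumerator_eq hs ht, meanCurvatureNumerator,
        meanCurvatureNumerator, h1, h2, du_add_right h1, du_add_right h2, dv_add_right h1,
        dv_add_right h2])
    (fun v => by
      have hH := meanCurvature_ellipticTorus_eq_zero cos_pi v
      rw [isTorusEmbedding_ellipticTorus.meanCurvature_eq, div_eq_zero_iff] at hH
      rw [spacetimeNumerator_eq hs h0, hF.initial_eq]
      exact hH.resolve_right (pow_ne_zero 3 (norm_ne_zero_iff.2
        (isTorusEmbedding_ellipticTorus.cross_ne_zero π v))))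
    (fun v => by
      rw [hF.slabDeriv_spacetimeNumerator hT hh]
      exact mul_neg_of_pos_of_neg (by positivity) (by linarith))
  refine ⟨ε, hε, hεT, fun t ht => ?_⟩
  have htT : t ∈ Ico 0 T := ⟨ht.1.le, ht.2.trans_le hεT⟩
  have hH : ∀ v, meanCurvature (F t) π v < 0 := fun v => by
    rw [(hF.immersion t htT).meanCurvature_neg_iff, ← spacetimeNumerator_eq hs htT]
    exact hneg t ht v
  exact ⟨hH, (ciInf_le (hF.immersion t htT).bddBelow_meanCurvature (π, 0)).trans_lt (hH 0)⟩

end Flow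

theorem mainTheorem2 :
    -- the surface is a smoothly embedded torus of revolution with elliptic section
    IsTorusEmbedding ellipticTorus ∧
    range (fun p : ℝ × ℝ => ellipticTorus p.1 p.2) = ellipticTorusSurface ∧
    -- the chosen unit normal is the outward one
    (∀ u v, ∀ᶠ s in 𝓝[>] (0 : ℝ),
      ellipticTorus u v - s • unitNormal ellipticTorus u v ∈ ellipticTorusDomain ∧
      ellipticTorus u v + s • unitNormal ellipticTorus u v ∉ closure ellipticTorusDomain) ∧
    -- `H` vanishes on the inner equator and is positive elsewhere
    (∀ u v, ellipticTorus u v ∈ innerEquator → meanCurvature ellipticTorus u v = 0) ∧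
    (∀ u v, ellipticTorus u v ∉ innerEquator → 0 < meanCurvature ellipticTorus u v) ∧
    -- negative mean curvature appears at once under both flows
    (∀ (T : ℝ) (F : ℝ → ℝ → ℝ → E3), 0 < T →
      (IsVPMCF ellipticTorus T F ∨ IsAPMCF ellipticTorus T F) →
      ∃ ε : ℝ, 0 < ε ∧ ε ≤ T ∧ ∀ t ∈ Ioo 0 ε,
        (∀ v, meanCurvature (F t) π v < 0) ∧
        (⨅ p : ℝ × ℝ, meanCurvature (F t) p.1 p.2) < 0) := by
  refine ⟨isTorusEmbedding_ellipticTorus, range_ellipticTorus, eventually_inside_and_outside,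
    fun u v h => meanCurvature_ellipticTorus_eq_zero ((mem_innerEquator_iff u v).1 h) v,
    fun u v h => meanCurvature_ellipticTorus_pos (mt (mem_innerEquator_iff u v).2 h) v, ?_⟩
  rintro T F hT (hF | ⟨hF, -⟩)
  · have hF : IsConstrainedMCF averageMeanCurvature ellipticTorus T F := hF
    refine hF.exists_meanCurvature_neg hT ?_ one_quarter_lt_averageMeanCurvature
    have h := tendsto_averageMeanCurvature hT (F := F) hF.smooth hF.immersion
    rw [hF.initial_eq] at h
    exact h area_ellipticTorus_pos.ne'
  · refine hF.exists_meanCurvature_neg hT ?_ one_quarter_lt_squareMeanCurvatureRatio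
    have h := tendsto_squareMeanCurvatureRatio hT (F := F) hF.smooth hF.immersion
    rw [hF.initial_eq] at h
    exact h totalMeanCurvature_ellipticTorus_pos.ne'
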